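/- Let $G$ be a nilpotent group with a finite symmetric generating set $S$ ($S=S^{-1}$), let $d$ be the word length metric of the Cayley graph of $(G,S)$ (vertices $G$, with $u,v$ adjacent when $u^{-1}v\in S$), and for $z\in G$ put $\psi_z(x):=d(x,z)-d(e,z)$. The horofunction boundary is $\overline{\{\psi_z\mid z\in G\}}\setminus\{\psi_z\mid z\in G\}$, the closure being taken in $\mathbb{R}^G$ with the topology of pointwise convergence (equivalently, of uniform convergence on finite sets), and $G$ acts on it by $(g\xi)(x)=\xi(g^{-1}x)-\xi(g^{-1})$. A geodesic path is a map $\gamma:\{0,1,2,\dots\}\to G$ with $d(\gamma(m),\gamma(n))=|m-n|$; it converges to $\xi$ if $\psi_{\gamma(n)}\to\xi$. A Busemann point is a point of the horofunction boundary that is the limit of a geodesic path. The direction of $\gamma$ is the set of elements $s$ such that $\gamma(n)^{-1}\gamma(n+1)=s$ for infinitely many $n$. Let $Z_0$ be the torsion subgroup of $G/[G,G]$, fix an isomorphism $(G/[G,G])/Z_0\cong\mathbb{Z}^N$, let $\phi:G\to\mathbb{Z}^N\subset\mathbb{R}^N$ be the resulting projection and let $P:=\operatorname{conv}(\phi(S))$.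 A facet of $P$ is a non-empty face of dimension $\dim P-1$. For a facet $F$ of $P$, let $V:=\{s\in S\mid \phi(s)\in F\}$. Simple commutators of elements of $V$ are the elements of $V$ and, recursively, the elements $[c,s]=c^{-1}s^{-1}cs$ with $c$ a simple commutator and $s\in V$. Call a finite word $w$ with letters in $V$ admissible for $F$ if for every simple commutator $c$ of elements of $V$ there are words $x_c,y_c$ with letters in $V$ that represent elements $\overline{x}_c,\overline{y}_c$ of $G$ with $c\,\overline{x}_c=\overline{y}_c$ and that both occur as (contiguous) subwords of $w$. Let $\xi_F$ denote the common limit of the paths that start at $e$ and have as steps the letters of the infinite word $www\cdots$, for $w$ admissible for $F$. Then: 1. For every Busemann point $\xi$ whose orbit under $G$ is finite there is a facet $F$ of $P$ such that the orbit of $\xi$ equals $\{g\xi_F\mid g\in G\}$. Here it is part of the claim that $\xi_F$ is well defined: words admissible for $F$ exist, and for all of them the path described above is geodesic and converges to the same point $\xi_F$. 2. If a geodesic path $\gamma$ converges to a point whose orbit under $G$ is finite, then $\phi$ maps the direction of $\gamma$ into some facet of $P$. -/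

import Mathlib

open Filter Topology

noncomputable section

namespace NilpotentHoro

/-! ### The Cayley graph, the word metric and the horofunction boundary -/

/-- The (undirected) Cayley graph: `u` and `v` are joined when `u⁻¹ * v ∈ S`. -/
def cayleyGraph {G : Type*} [Group G] (S : Set G) : SimpleGraph G :=
  SimpleGraph.fromRel fun u v => u⁻¹ * v ∈ S

/-- Word length distance: length of a shortest path in the Cayley graph. -/
def wordDist {G : Type*} [Group G] (S : Set G) (u v : G) : ℕ :=
  (cayleyGraph S).dist u v

/-- `ψ_z(x) = d(x, z) - d(1, z)`. Since `G` is discrete, compact subsets of `G` are finite, so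
uniform convergence on compact sets is convergence in the product topology of `G → ℝ`. -/
def psi {G : Type*} [Group G] (S : Set G) (z : G) : G → ℝ :=
  fun x => (wordDist S x z : ℝ) - (wordDist S 1 z : ℝ)

/-- The horofunction boundary. -/
def horoBoundary {G : Type*} [Group G] (S : Set G) : Set (G → ℝ) :=
  closure (Set.range (psi S)) \ Set.range (psi S)

/-- The action `(g · ξ)(x) = ξ(g⁻¹ x) - ξ(g⁻¹)` of `G` on functions normalised at `1`. -/
def horoAct {G : Type*} [Group G] (g : G) (ξ : G → ℝ) : G → ℝ :=
  fun x => ξ (g⁻¹ * x) - ξ g⁻¹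

/-- The orbit `{g · ξ | g ∈ G}`. -/
def horoOrbit {G : Type*} [Group G] (ξ : G → ℝ) : Set (G → ℝ) :=
  Set.range fun g : G => horoAct g ξ

/-- A geodesic path (indexed by times `0, 1, 2, …`): an isometry into the word metric. -/
def IsGeodesicPath {G : Type*} [Group G] (S : Set G) (γ : ℕ → G) : Prop :=
  ∀ m n : ℕ, (wordDist S (γ m) (γ n) : ℤ) = |(m : ℤ) - (n : ℤ)|

/-- The path `γ` converges to `ξ` in the horofunction compactification. -/
def ConvergesTo {G : Type*} [Group G] (S : Set G) (γ : ℕ → G) (ξ : G → ℝ) : Prop :=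
  Tendsto (fun n => psi S (γ n)) atTop (𝓝 ξ)

/-- Busemann points: points of the horofunction boundary that are limits of geodesic paths. -/
def IsBusemannPoint {G : Type*} [Group G] (S : Set G) (ξ : G → ℝ) : Prop :=
  ξ ∈ horoBoundary S ∧ ∃ γ : ℕ → G, IsGeodesicPath S γ ∧ ConvergesTo S γ ξ

/-- The direction of a path: the set of elements occurring infinitely often as steps. -/
def direction {G : Type*} [Group G] (γ : ℕ → G) : Set G :=
  {s | ∃ᶠ n in atTop, (γ n)⁻¹ * γ (n + 1) = s}

/-! ### The projection to the free part of the abelianisation, the polytope and its facets -/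

/-- The free part of the abelianisation: `(G/[G,G])/Z₀`, with `Z₀` the torsion subgroup. -/
abbrev FreeAb (G : Type*) [Group G] : Type _ :=
  Abelianization G ⧸ CommGroup.torsion (Abelianization G)

/-- The projection `φ : G → ℤ^N ⊂ ℝ^N`, given an identification `e` of the free part of the
abelianisation with `ℤ^N`. -/
def phi {G : Type*} [Group G] {N : ℕ} (e : FreeAb G ≃* Multiplicative (Fin N → ℤ)) (g : G) :
    Fin N → ℝ :=
  fun i => ((Multiplicative.toAdd (e (QuotientGroup.mk (Abelianization.of g))) i : ℤ) : ℝ)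

/-- The polytope `P = conv(φ(S))`. -/
def genPolytope {G : Type*} [Group G] (S : Set G) {N : ℕ}
    (e : FreeAb G ≃* Multiplicative (Fin N → ℤ)) : Set (Fin N → ℝ) :=
  convexHull ℝ (phi e '' S)

/-- Facets of a polytope `P`: non-empty faces of dimension `dim P - 1`. -/
def IsFacet {N : ℕ} (P F : Set (Fin N → ℝ)) : Prop :=
  F.Nonempty ∧ IsExposed ℝ P F ∧
    Module.finrank ℝ (vectorSpan ℝ F) + 1 = Module.finrank ℝ (vectorSpan ℝ P)

/-- The set `V` of generators mapped into `F` by `φ`. -/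
def facetGens {G : Type*} [Group G] (S : Set G) {N : ℕ}
    (e : FreeAb G ≃* Multiplicative (Fin N → ℤ)) (F : Set (Fin N → ℝ)) : Set G :=
  {s | s ∈ S ∧ phi e s ∈ F}

/-! ### The point `ξ_F` -/

/-- Simple commutators (of any weight `≥ 1`) of elements of `V`,
with `[a, b] = a⁻¹ b⁻¹ a b`. -/
inductive IsSimpleCommutator {G : Type*} [Group G] (V : Set G) : G → Prop
  | base (s : G) (hs : s ∈ V) : IsSimpleCommutator V s
  | step (c s : G) (hc : IsSimpleCommutator V c) (hs : s ∈ V) :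
      IsSimpleCommutator V (c⁻¹ * s⁻¹ * c * s)

/-- The admissible words `w_F`: words in `V` such that for each simple commutator `c` of elements
of `V` there are words `x_c`, `y_c` in `V` with `c x_c = y_c` in `G`,
both of which are (contiguous) subwords of `w_F`. -/
def IsFacetWord {G : Type*} [Group G] (V : Set G) (w : List G) : Prop :=
  (∀ s ∈ w, s ∈ V) ∧
    ∀ c : G, IsSimpleCommutator V c →
      ∃ x y : List G, (∀ s ∈ x, s ∈ V) ∧ (∀ s ∈ y, s ∈ V) ∧
        c * x.prod = y.prod ∧ x <:+: w ∧ y <:+: w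

/-- The path starting at `1` whose steps are the letters of the infinite word `w w w ⋯`. -/
def periodicPath {G : Type*} [Group G] (w : List G) (n : ℕ) : G :=
  ((List.range n).map fun i => w.getD (i % w.length) 1).prod

/-- `ξ` is the point `ξ_F`: admissible words `w_F` exist, and for each of them
the path `Λ_F` with steps `w_F w_F ⋯` is geodesic and converges to `ξ`. -/
def IsFacetPoint {G : Type*} [Group G] (S : Set G) {N : ℕ}
    (e : FreeAb G ≃* Multiplicative (Fin N → ℤ)) (F : Set (Fin N → ℝ)) (ξ : G → ℝ) : Prop :=
  (∃ w : List G, IsFacetWord (facetGens S e F) w) ∧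
    ∀ w : List G, IsFacetWord (facetGens S e F) w →
      IsGeodesicPath S (periodicPath w) ∧ ConvergesTo S (periodicPath w) ξ

end NilpotentHoro

end

/-! Let a geodesic `γ` converge to `ξ` with finite orbit. On the finite-index normal subgroup `K`
fixing the orbit pointwise, `ξ` is additive, and nilpotency makes it conjugation invariant there,
because its values on each conjugacy class are bounded. Hence minus the average over the orbit is a
homomorphism `L : G → ℝ` with `L ≤ 1` on `S` and `L + ξ` bounded
(`exists_additive_near_horofunction`). Once `γ` is normalised to start at `1`, `ξ (γ n) ≤ -n`, so `n
- L (γ n)` stays bounded and a step with `L < 1` cannot recur forever: the direction lies in `{L =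
1}`. Now `L` is a linear functional composed with `phi e`; tilting that functional until its tight
points span gives a facet without losing any tight generator (`exists_tight_spanning`,
`isFacet_of_tight_spanning`). This is claim 2.

For claim 1, let `L` cut out the facet and let `V = {s ∈ S | L s = 1}`. Since `L` bounds the
distance from below, all words in `V` are geodesic. Limits of such paths are compared by absorption:
if every point of `γ` can be joined optimally to a later point of `γ'`, the limit of `γ'` lies below
that of `γ` (`limit_le_limit`). If `w` is admissible and `g` lies in the group generated by `V`,
then `g * w.prod ^ q` is a product of elements of `V` for all large `q`
(`IsFacetWord.exists_mul_pow_mem`). So the periodic path of `w` absorbs every `V`-path from `1`; its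
limit is the least one and does not depend on `w`. Conversely, a limit with finite orbit equals `-L`
on `K`, which contains powers of `w.prod`, and this yields absorption the other way
(`limit_le_limit_periodicPath`). Thus a tail of `γ`, translated to start at `1`, converges exactly
to the facet point. -/

namespace NilpotentHoro

/-! ### The word metric -/

section WordMetric

variable {G : Type*} [Group G] {S : Set G}

lemma cayleyGraph_adj (hsymm : ∀ s ∈ S, s⁻¹ ∈ S) {u v : G} :
    (cayleyGraph S).Adj u v ↔ u ≠ v ∧ u⁻¹ * v ∈ S := by
  rw [cayleyGraph, SimpleGraph.fromRel_adj]
  refine and_congr_right fun _ => ⟨?_, Or.inl⟩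
  rintro (h | h)
  · exact h
  · simpa using hsymm _ h

lemma cayleyGraph_reachable_mul (hsymm : ∀ s ∈ S, s⁻¹ ∈ S) {s : G} (hs : s ∈ S) (u : G) :
    (cayleyGraph S).Reachable u (u * s) := by
  by_cases h : u = u * s
  · rw [← h]
  · exact ((cayleyGraph_adj hsymm).2 ⟨h, by simpa using hs⟩).reachable

lemma cayleyGraph_connected (hgen : Subgroup.closure S = ⊤) (hsymm : ∀ s ∈ S, s⁻¹ ∈ S) :
    (cayleyGraph S).Connected := by
  have key : ∀ g : G, ∀ u, (cayleyGraph S).Reachable u (u * g) := by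
    intro g
    have hg : g ∈ Subgroup.closure S := hgen ▸ Subgroup.mem_top g
    induction hg using Subgroup.closure_induction with
    | mem x hx => exact cayleyGraph_reachable_mul hsymm hx
    | one => intro u; rw [mul_one]
    | mul x y _ _ hx hy =>
      intro u
      rw [← mul_assoc]
      exact (hx u).trans (hy _)
    | inv x _ hx =>
      intro u
      simpa using (hx (u * x⁻¹)).symm
  have : Nonempty G := ⟨1⟩
  refine ⟨fun u v => ?_⟩
  simpa using key (u⁻¹ * v) u

lemma wordDist_self (u : G) : wordDist S u u = 0 := SimpleGraph.dist_self

lemma wordDist_comm (u v : G) : wordDist S u v = wordDist S v u := SimpleGraph.dist_comm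

lemma wordDist_triangle (hgen : Subgroup.closure S = ⊤) (hsymm : ∀ s ∈ S, s⁻¹ ∈ S) (u v w : G) :
    wordDist S u w ≤ wordDist S u v + wordDist S v w :=
  (cayleyGraph_connected hgen hsymm).dist_triangle

lemma wordDist_mul_left_le (hgen : Subgroup.closure S = ⊤) (hsymm : ∀ s ∈ S, s⁻¹ ∈ S) (g u v : G) :
    wordDist S (g * u) (g * v) ≤ wordDist S u v := by
  obtain ⟨p, hp⟩ := (cayleyGraph_connected hgen hsymm).exists_walk_length_eq_dist u v
  let f : cayleyGraph S →g cayleyGraph S :=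
    ⟨fun x => g * x, fun {a b} h => by
      rw [cayleyGraph_adj hsymm] at h ⊢
      refine ⟨fun h' => h.1 (mul_left_cancel h'), ?_⟩
      simpa [mul_assoc] using h.2⟩
  have := SimpleGraph.dist_le (p.map f)
  rw [SimpleGraph.Walk.length_map, hp] at this
  exact this

lemma wordDist_mul_left (hgen : Subgroup.closure S = ⊤) (hsymm : ∀ s ∈ S, s⁻¹ ∈ S) (g u v : G) :
    wordDist S (g * u) (g * v) = wordDist S u v := by
  refine le_antisymm (wordDist_mul_left_le hgen hsymm g u v) ?_
  simpa using wordDist_mul_left_le hgen hsymm g⁻¹ (g * u) (g * v)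

lemma wordDist_mul_right_le_one (hsymm : ∀ s ∈ S, s⁻¹ ∈ S) {s : G} (hs : s ∈ S) (u : G) :
    wordDist S u (u * s) ≤ 1 := by
  by_cases h : u = u * s
  · rw [← h, wordDist_self]; exact zero_le_one
  · exact (SimpleGraph.dist_eq_one_iff_adj.2
      ((cayleyGraph_adj hsymm).2 ⟨h, by simpa using hs⟩)).le

lemma mem_of_wordDist_eq_one (hsymm : ∀ s ∈ S, s⁻¹ ∈ S) {u v : G} (h : wordDist S u v = 1) :
    u⁻¹ * v ∈ S :=
  ((cayleyGraph_adj hsymm).1 (SimpleGraph.dist_eq_one_iff_adj.1 h)).2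

lemma wordDist_mul_list_prod_le (hgen : Subgroup.closure S = ⊤) (hsymm : ∀ s ∈ S, s⁻¹ ∈ S)
    (l : List G) (hl : ∀ s ∈ l, s ∈ S) (u : G) : wordDist S u (u * l.prod) ≤ l.length := by
  induction l generalizing u with
  | nil => simp [wordDist_self]
  | cons a l ih =>
    have h1 := wordDist_mul_right_le_one hsymm (hl a (by simp)) u
    have h2 := ih (fun s hs => hl s (by simp [hs])) (u * a)
    have h3 := wordDist_triangle hgen hsymm u (u * a) (u * a * l.prod)
    rw [List.prod_cons, ← mul_assoc, List.length_cons]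
    omega

/-! ### Additive functionals bounded by `1` on the generators -/

variable {L : G → ℝ}

lemma additive_one (hL : ∀ a b, L (a * b) = L a + L b) : L 1 = 0 := by
  have := hL 1 1
  rw [mul_one] at this
  linarith

lemma additive_inv (hL : ∀ a b, L (a * b) = L a + L b) (a : G) : L a⁻¹ = -L a := by
  have := hL a a⁻¹
  rw [mul_inv_cancel, additive_one hL] at this
  linarith

lemma additive_list_prod (hL : ∀ a b, L (a * b) = L a + L b) (l : List G)
    (hl : ∀ s ∈ l, L s = 1) : L l.prod = l.length := by
  induction l with
  | nil => simp [additive_one hL]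
  | cons a l ih =>
    rw [List.prod_cons, hL, hl a (by simp), ih fun s hs => hl s (by simp [hs]),
      List.length_cons]
    push_cast; ring

lemma additive_walk (hsymm : ∀ s ∈ S, s⁻¹ ∈ S) (hL : ∀ a b, L (a * b) = L a + L b)
    (hS : ∀ s ∈ S, L s ≤ 1) {u v : G} (p : (cayleyGraph S).Walk u v) :
    L (u⁻¹ * v) ≤ p.length := by
  induction p with
  | nil => simp [additive_one hL]
  | @cons u v w h p ih =>
    have h1 := hS _ ((cayleyGraph_adj hsymm).1 h).2
    have e : u⁻¹ * w = (u⁻¹ * v) * (v⁻¹ * w) := by group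
    rw [SimpleGraph.Walk.length_cons, e, hL]
    push_cast
    linarith

lemma additive_le_wordDist (hgen : Subgroup.closure S = ⊤) (hsymm : ∀ s ∈ S, s⁻¹ ∈ S)
    (hL : ∀ a b, L (a * b) = L a + L b) (hS : ∀ s ∈ S, L s ≤ 1) (u v : G) :
    L (u⁻¹ * v) ≤ wordDist S u v := by
  obtain ⟨p, hp⟩ := (cayleyGraph_connected hgen hsymm).exists_walk_length_eq_dist u v
  have := additive_walk hsymm hL hS p
  rwa [hp] at this

/-- Each letter with `L = 1` gains the maximum possible, so a word in such letters attains the lower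
bound given by `L`. -/
lemma wordDist_eq_additive (hgen : Subgroup.closure S = ⊤) (hsymm : ∀ s ∈ S, s⁻¹ ∈ S)
    (hL : ∀ a b, L (a * b) = L a + L b) (hS : ∀ s ∈ S, L s ≤ 1) {u v : G}
    (h : u⁻¹ * v ∈ Submonoid.closure {s | s ∈ S ∧ L s = 1}) :
    (wordDist S u v : ℝ) = L (u⁻¹ * v) := by
  refine le_antisymm ?_ (additive_le_wordDist hgen hsymm hL hS u v)
  obtain ⟨l, hl, hp⟩ := Submonoid.exists_list_of_mem_closure h
  have h1 := wordDist_mul_list_prod_le hgen hsymm l (fun s hs => (hl s hs).1) u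
  rw [← hp, additive_list_prod hL l fun s hs => (hl s hs).2]
  rw [hp, mul_inv_cancel_left] at h1
  exact_mod_cast h1

end WordMetric

/-! ### Geodesic paths and horofunctions -/

section Geodesic

variable {G : Type*} [Group G] {S : Set G}

lemma IsGeodesicPath.wordDist_of_le {γ : ℕ → G} (hγ : IsGeodesicPath S γ) {m n : ℕ} (h : m ≤ n) :
    (wordDist S (γ m) (γ n) : ℤ) = n - m := by
  rw [hγ m n, abs_sub_comm, abs_of_nonneg]
  exact sub_nonneg.2 (by exact_mod_cast h)

lemma IsGeodesicPath.antitone (hgen : Subgroup.closure S = ⊤) (hsymm : ∀ s ∈ S, s⁻¹ ∈ S)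
    {γ : ℕ → G} (hγ : IsGeodesicPath S γ) (x : G) :
    Antitone fun n : ℕ => (wordDist S x (γ n) : ℤ) - n := by
  intro m n h
  have h1 := wordDist_triangle hgen hsymm x (γ m) (γ n)
  have h2 := hγ.wordDist_of_le h
  dsimp only
  omega

/-- The sequence is integer valued, nonincreasing and bounded below by the triangle inequality
through `γ 0`, so it attains its minimum and stays there. -/
lemma IsGeodesicPath.eventually_const (hgen : Subgroup.closure S = ⊤) (hsymm : ∀ s ∈ S, s⁻¹ ∈ S)
    {γ : ℕ → G} (hγ : IsGeodesicPath S γ) (x : G) :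
    ∃ c : ℤ, ∀ᶠ n : ℕ in atTop, (wordDist S x (γ n) : ℤ) - n = c := by
  have hb : ∀ n : ℕ, -(wordDist S (γ 0) x : ℤ) ≤ (wordDist S x (γ n) : ℤ) - n := by
    intro n
    have h1 := wordDist_triangle hgen hsymm (γ 0) x (γ n)
    have h2 := hγ.wordDist_of_le (Nat.zero_le n)
    omega
  obtain ⟨c, ⟨n, hn⟩, hc⟩ := Int.exists_least_of_bdd
    (P := fun c => ∃ n : ℕ, (wordDist S x (γ n) : ℤ) - n = c)
    ⟨_, by rintro z ⟨n, rfl⟩; exact hb n⟩ ⟨_, 0, rfl⟩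
  refine ⟨c, eventually_atTop.2 ⟨n, fun m hm => le_antisymm ?_ (hc _ ⟨m, rfl⟩)⟩⟩
  rw [← hn]
  exact hγ.antitone hgen hsymm x hm

lemma IsGeodesicPath.psi_apply {γ : ℕ → G} (hγ : IsGeodesicPath S γ) (h0 : γ 0 = 1) (x : G)
    (n : ℕ) : psi S (γ n) x = (((wordDist S x (γ n) : ℤ) - n : ℤ) : ℝ) := by
  have h2 := hγ.wordDist_of_le (Nat.zero_le n)
  rw [h0] at h2
  have h3 : wordDist S 1 (γ n) = n := by omega
  simp [psi, h3]

lemma IsGeodesicPath.exists_convergesTo (hgen : Subgroup.closure S = ⊤)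
    (hsymm : ∀ s ∈ S, s⁻¹ ∈ S) {γ : ℕ → G} (hγ : IsGeodesicPath S γ) (h0 : γ 0 = 1) :
    ∃ η : G → ℝ, ConvergesTo S γ η := by
  choose c hc using hγ.eventually_const hgen hsymm
  refine ⟨fun x => (c x : ℝ), tendsto_pi_nhds.2 fun x => ?_⟩
  refine tendsto_const_nhds.congr' ?_
  filter_upwards [hc x] with n hn
  rw [hγ.psi_apply h0, hn]

lemma IsGeodesicPath.eventually_eq (hgen : Subgroup.closure S = ⊤)
    (hsymm : ∀ s ∈ S, s⁻¹ ∈ S) {γ : ℕ → G} (hγ : IsGeodesicPath S γ) (h0 : γ 0 = 1) {η : G → ℝ}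
    (hη : ConvergesTo S γ η) (x : G) :
    ∀ᶠ n : ℕ in atTop, η x = (wordDist S x (γ n) : ℝ) - n := by
  obtain ⟨c, hc⟩ := hγ.eventually_const hgen hsymm x
  have h1 : Tendsto (fun n => psi S (γ n) x) atTop (𝓝 (c : ℝ)) := by
    refine tendsto_const_nhds.congr' ?_
    filter_upwards [hc] with n hn
    rw [hγ.psi_apply h0, hn]
  have h2 := tendsto_nhds_unique (tendsto_pi_nhds.1 hη x) h1
  filter_upwards [hc] with n hn
  rw [h2, ← hn]; push_cast; rfl

lemma IsGeodesicPath.limit_le (hgen : Subgroup.closure S = ⊤)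
    (hsymm : ∀ s ∈ S, s⁻¹ ∈ S) {γ : ℕ → G} (hγ : IsGeodesicPath S γ) (h0 : γ 0 = 1) {η : G → ℝ}
    (hη : ConvergesTo S γ η) (x : G) (n : ℕ) : η x ≤ (wordDist S x (γ n) : ℝ) - n := by
  obtain ⟨m, hm, hnm⟩ := ((hγ.eventually_eq hgen hsymm h0 hη x).and (eventually_ge_atTop n)).exists
  rw [hm]
  have := hγ.antitone hgen hsymm x hnm
  dsimp only at this
  exact_mod_cast this

/-- The hypothesis says that `γ'` absorbs `γ`: following `γ` up to time `m` and then crossing over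
to `γ' n` costs at most `n`. -/
lemma limit_le_limit (hgen : Subgroup.closure S = ⊤)
    (hsymm : ∀ s ∈ S, s⁻¹ ∈ S) {γ γ' : ℕ → G} (hγ : IsGeodesicPath S γ) (h0 : γ 0 = 1)
    (hγ' : IsGeodesicPath S γ') (h0' : γ' 0 = 1) {η η' : G → ℝ}
    (hη : ConvergesTo S γ η) (hη' : ConvergesTo S γ' η')
    (h : ∀ m, ∃ n : ℕ, (wordDist S (γ m) (γ' n) : ℝ) ≤ n - m) : η' ≤ η := by
  intro x
  obtain ⟨m, hm⟩ := (hγ.eventually_eq hgen hsymm h0 hη x).exists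
  obtain ⟨n, hn⟩ := h m
  have h1 := hγ'.limit_le hgen hsymm h0' hη' x n
  have h2 : (wordDist S x (γ' n) : ℝ) ≤ wordDist S x (γ m) + wordDist S (γ m) (γ' n) := by
    exact_mod_cast wordDist_triangle hgen hsymm x (γ m) (γ' n)
  linarith

lemma ConvergesTo.apply_one {γ : ℕ → G} {ξ : G → ℝ} (h : ConvergesTo S γ ξ) : ξ 1 = 0 := by
  refine tendsto_nhds_unique (tendsto_pi_nhds.1 h 1) ?_
  simp [psi]

lemma ConvergesTo.sub_le (hgen : Subgroup.closure S = ⊤) (hsymm : ∀ s ∈ S, s⁻¹ ∈ S)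
    {γ : ℕ → G} {ξ : G → ℝ} (h : ConvergesTo S γ ξ) (x y : G) : ξ x - ξ y ≤ wordDist S x y := by
  refine le_of_tendsto' ((tendsto_pi_nhds.1 h x).sub (tendsto_pi_nhds.1 h y)) fun n => ?_
  have h2 : (wordDist S x (γ n) : ℝ) ≤ wordDist S x y + wordDist S y (γ n) := by
    exact_mod_cast wordDist_triangle hgen hsymm x y (γ n)
  simp only [psi]
  linarith

/-! ### The action on horofunctions -/

lemma horoAct_mul (g h : G) (ξ : G → ℝ) : horoAct (g * h) ξ = horoAct g (horoAct h ξ) := by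
  funext x
  simp only [horoAct, mul_inv_rev, mul_assoc]
  ring

lemma horoAct_one {ξ : G → ℝ} (h : ξ 1 = 0) : horoAct 1 ξ = ξ := by
  funext x
  simp [horoAct, h]

lemma horoAct_apply_one (g : G) (ξ : G → ℝ) : horoAct g ξ 1 = 0 := by
  simp [horoAct]

lemma horoOrbit_horoAct (g : G) (ξ : G → ℝ) : horoOrbit (horoAct g ξ) = horoOrbit ξ := by
  ext η
  constructor
  · rintro ⟨h, rfl⟩
    exact ⟨h * g, horoAct_mul _ _ _⟩
  · rintro ⟨h, rfl⟩
    refine ⟨h * g⁻¹, ?_⟩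
    dsimp only
    rw [← horoAct_mul, inv_mul_cancel_right]

lemma IsGeodesicPath.translate_tail (hgen : Subgroup.closure S = ⊤) (hsymm : ∀ s ∈ S, s⁻¹ ∈ S)
    {γ : ℕ → G} (hγ : IsGeodesicPath S γ) (g : G) (k : ℕ) :
    IsGeodesicPath S fun n => g * γ (k + n) := by
  intro m n
  rw [wordDist_mul_left hgen hsymm, hγ]
  push_cast
  congr 1
  ring

lemma ConvergesTo.translate_tail (hgen : Subgroup.closure S = ⊤) (hsymm : ∀ s ∈ S, s⁻¹ ∈ S)
    {γ : ℕ → G} {ξ : G → ℝ} (h : ConvergesTo S γ ξ) (g : G) (k : ℕ) :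
    ConvergesTo S (fun n => g * γ (k + n)) (horoAct g ξ) := by
  have h' := tendsto_pi_nhds.1 h
  refine tendsto_pi_nhds.2 fun x => ?_
  have h1 : Tendsto (fun n => psi S (γ (k + n)) (g⁻¹ * x) - psi S (γ (k + n)) g⁻¹) atTop
      (𝓝 (horoAct g ξ x)) := by
    have ht : Tendsto (fun n => k + n) atTop atTop := tendsto_atTop_mono (fun n => Nat.le_add_left n k) tendsto_id
    exact ((h' (g⁻¹ * x)).comp ht).sub ((h' g⁻¹).comp ht)
  refine h1.congr fun n => ?_
  have e1 := wordDist_mul_left hgen hsymm g (g⁻¹ * x) (γ (k + n))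
  have e2 := wordDist_mul_left hgen hsymm g g⁻¹ (γ (k + n))
  rw [mul_inv_cancel_left] at e1
  rw [mul_inv_cancel] at e2
  simp only [psi]
  rw [e1, e2]
  ring

end Geodesic

/-! ### Simple commutators by weight -/

section Commutators

variable {G : Type*} [Group G]

/-- Simple commutators of weight `k + 1` of elements of `V`. -/
def simpleCommutators (V : Set G) : ℕ → Set G
  | 0 => V
  | k + 1 => Set.image2 (fun c s => c⁻¹ * s⁻¹ * c * s) (simpleCommutators V k) V

/-- The subgroup generated by the simple commutators of weight greater than `k`. -/
def commutatorFiltration (V : Set G) (k : ℕ) : Subgroup G :=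
  Subgroup.closure {c | ∃ j, k ≤ j ∧ c ∈ simpleCommutators V j}

lemma IsSimpleCommutator.exists_weight {V : Set G} {c : G} (h : IsSimpleCommutator V c) :
    ∃ k, c ∈ simpleCommutators V k := by
  induction h with
  | base s hs => exact ⟨0, hs⟩
  | step c s _ hs ih =>
    obtain ⟨k, hk⟩ := ih
    exact ⟨k + 1, Set.mem_image2_of_mem hk hs⟩

lemma isSimpleCommutator_of_mem {V : Set G} {k : ℕ} {c : G} (h : c ∈ simpleCommutators V k) :
    IsSimpleCommutator V c := by
  induction k generalizing c with
  | zero => exact .base c h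
  | succ k ih =>
    obtain ⟨c, hc, s, hs, rfl⟩ := h
    exact .step c s (ih hc) hs

lemma simpleCommutators_subset_closure (V : Set G) (k : ℕ) :
    simpleCommutators V k ⊆ Subgroup.closure V := by
  induction k with
  | zero => exact Subgroup.subset_closure
  | succ k ih =>
    rintro _ ⟨c, hc, s, hs, rfl⟩
    have hs' : s ∈ Subgroup.closure V := Subgroup.subset_closure hs
    exact mul_mem (mul_mem (mul_mem (inv_mem (ih hc)) (inv_mem hs')) (ih hc)) hs'

lemma simpleCommutators_finite {V : Set G} (hV : V.Finite) (k : ℕ) :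
    (simpleCommutators V k).Finite := by
  induction k with
  | zero => exact hV
  | succ k ih => exact ih.image2 _ hV

lemma commutator_mem_lowerCentralSeries_succ {k : ℕ} {c : G}
    (hc : c ∈ (⊤ : Subgroup G).lowerCentralSeries k) (s : G) :
    c⁻¹ * s⁻¹ * c * s ∈ (⊤ : Subgroup G).lowerCentralSeries (k + 1) := by
  have := Subgroup.commutator_mem_commutator (inv_mem hc) (Subgroup.mem_top s⁻¹)
  rw [commutatorElement_def, inv_inv, inv_inv] at this
  rw [Subgroup.lowerCentralSeries_succ]
  exact this

lemma simpleCommutators_subset_lowerCentralSeries (V : Set G) (k : ℕ) :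
    simpleCommutators V k ⊆ (⊤ : Subgroup G).lowerCentralSeries k := by
  induction k with
  | zero => intro c _; exact Subgroup.mem_top c
  | succ k ih =>
    rintro _ ⟨c, hc, s, hs, rfl⟩
    exact commutator_mem_lowerCentralSeries_succ (ih hc) s

lemma exists_simpleCommutators_trivial [Group.IsNilpotent G] (V : Set G) :
    ∃ n, ∀ k, n ≤ k → simpleCommutators V k ⊆ {1} := by
  obtain ⟨n, hn⟩ := Subgroup.nilpotent_iff_lowerCentralSeries.1 (inferInstance : Group.IsNilpotent G)
  refine ⟨n, fun k hk c hc => ?_⟩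
  have := Subgroup.lowerCentralSeries_antitone _ hk (simpleCommutators_subset_lowerCentralSeries V k hc)
  rw [hn] at this
  exact this

lemma finite_isSimpleCommutator [Group.IsNilpotent G] {V : Set G} (hV : V.Finite) :
    {c | IsSimpleCommutator V c}.Finite := by
  obtain ⟨n, hn⟩ := exists_simpleCommutators_trivial V
  refine ((Set.Finite.biUnion (Set.finite_lt_nat n)
    fun k _ => simpleCommutators_finite hV k).union (Set.finite_singleton 1)).subset ?_
  intro c hc
  obtain ⟨k, hk⟩ := hc.exists_weight
  rcases lt_or_ge k n with h | h
  · exact Or.inl (Set.mem_biUnion h hk)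
  · exact Or.inr (hn k h hk)

lemma commutatorFiltration_antitone (V : Set G) : Antitone (commutatorFiltration V) :=
  fun _ _ h => Subgroup.closure_mono fun _ ⟨j, hj, hc⟩ => ⟨j, h.trans hj, hc⟩

lemma commutatorFiltration_eq_bot [Group.IsNilpotent G] (V : Set G) :
    ∃ n, commutatorFiltration V n = ⊥ := by
  obtain ⟨n, hn⟩ := exists_simpleCommutators_trivial V
  refine ⟨n, (Subgroup.closure_eq_bot_iff).2 ?_⟩
  rintro c ⟨j, hj, hc⟩
  exact hn j hj hc

lemma mem_normalizer_of_conj_mem {N : Subgroup G} {s : G} (h1 : ∀ x ∈ N, s * x * s⁻¹ ∈ N)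
    (h2 : ∀ x ∈ N, s⁻¹ * x * s ∈ N) : s ∈ Subgroup.normalizer (N : Set G) := by
  refine Subgroup.mem_normalizer_iff.2 fun x => ⟨h1 x, fun h => ?_⟩
  simpa [mul_assoc] using h2 _ h

lemma conj_mem_of_closure {T : Set G} {N : Subgroup G} {s : G} (h : ∀ x ∈ T, s * x * s⁻¹ ∈ N)
    {x : G} (hx : x ∈ Subgroup.closure T) : s * x * s⁻¹ ∈ N := by
  have : Subgroup.closure T ≤ N.comap (MulAut.conj s).toMonoidHom :=
    (Subgroup.closure_le _).2 fun x hx => h x hx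
  exact this hx

/-- Descending induction from the trivial end of the filtration: conjugating a commutator `c` by `s`
changes it by a factor from the next level, which is already normalised. -/
lemma closure_le_normalizer_commutatorFiltration [Group.IsNilpotent G] (V : Set G) (k : ℕ) :
    Subgroup.closure V ≤ Subgroup.normalizer (commutatorFiltration V k : Set G) := by
  obtain ⟨n, hn⟩ := commutatorFiltration_eq_bot V
  have key : ∀ i k, n ≤ k + i → Subgroup.closure V ≤ Subgroup.normalizer (commutatorFiltration V k : Set G) := by
    intro i
    induction i with
    | zero =>
      intro k hk
      have : commutatorFiltration V k = ⊥ :=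
        le_bot_iff.1 (hn ▸ commutatorFiltration_antitone V hk)
      rw [this]
      intro s _
      exact mem_normalizer_of_conj_mem (by simp) (by simp)
    | succ i ih =>
      intro k hk
      have hN := ih (k + 1) (by omega)
      refine (Subgroup.closure_le _).2 fun s hs => ?_
      have hgen : ∀ c, (∃ j, k ≤ j ∧ c ∈ simpleCommutators V j) →
          c ∈ commutatorFiltration V k ∧
            c⁻¹ * s⁻¹ * c * s ∈ commutatorFiltration V (k + 1) := by
        rintro c ⟨j, hj, hc⟩
        exact ⟨Subgroup.subset_closure ⟨j, hj, hc⟩,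
          Subgroup.subset_closure ⟨j + 1, by omega, Set.mem_image2_of_mem hc hs⟩⟩
      have hle := commutatorFiltration_antitone V (Nat.le_succ k)
      refine mem_normalizer_of_conj_mem (fun x hx => conj_mem_of_closure (fun c hc => ?_) hx)
        (fun x hx => ?_)
      · obtain ⟨h1, h2⟩ := hgen c hc
        have h3 := (Subgroup.mem_normalizer_iff.1 (hN (Subgroup.subset_closure hs)) _).1
          (inv_mem h2)
        have e : s * c * s⁻¹ = c * (s * (c⁻¹ * s⁻¹ * c * s)⁻¹ * s⁻¹) := by group
        rw [e]
        exact mul_mem h1 (hle h3)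
      · have := conj_mem_of_closure (s := s⁻¹) (N := commutatorFiltration V k) (fun c hc => ?_) hx
        · simpa using this
        · obtain ⟨h1, h2⟩ := hgen c hc
          have e : s⁻¹ * c * s⁻¹⁻¹ = c * (c⁻¹ * s⁻¹ * c * s) := by group
          rw [e]
          exact mul_mem h1 (hle h2)
  exact key n k (by omega)

lemma conj_mem_commutatorFiltration [Group.IsNilpotent G] {V : Set G} {k : ℕ} {g x : G}
    (hg : g ∈ Subgroup.closure V) (hx : x ∈ commutatorFiltration V k) :
    g * x * g⁻¹ ∈ commutatorFiltration V k :=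
  (Subgroup.mem_normalizer_iff.1 (closure_le_normalizer_commutatorFiltration V k hg) _).1 hx

lemma conj_mem_commutatorFiltration' [Group.IsNilpotent G] {V : Set G} {k : ℕ} {g x : G}
    (hg : g ∈ Subgroup.closure V) (hx : x ∈ commutatorFiltration V k) :
    g⁻¹ * x * g ∈ commutatorFiltration V k := by
  simpa using conj_mem_commutatorFiltration (inv_mem hg) hx

lemma commutator_mem_commutatorFiltration [Group.IsNilpotent G] {V : Set G} {j : ℕ} {c g : G}
    (hc : c ∈ simpleCommutators V j) (hg : g ∈ Subgroup.closure V) :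
    c⁻¹ * g⁻¹ * c * g ∈ commutatorFiltration V (j + 1) := by
  induction hg using Subgroup.closure_induction with
  | mem s hs => exact Subgroup.subset_closure ⟨j + 1, le_rfl, Set.mem_image2_of_mem hc hs⟩
  | one => simp
  | mul x y hx hy ihx ihy =>
    have e : c⁻¹ * (x * y)⁻¹ * c * (x * y) =
        (c⁻¹ * y⁻¹ * c * y) * (y⁻¹ * (c⁻¹ * x⁻¹ * c * x) * y) := by group
    rw [e]
    exact mul_mem ihy (conj_mem_commutatorFiltration' hy ihx)
  | inv x hx ihx =>
    have e : c⁻¹ * x⁻¹⁻¹ * c * x⁻¹ = x * (c⁻¹ * x⁻¹ * c * x)⁻¹ * x⁻¹ := by group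
    rw [e]
    exact conj_mem_commutatorFiltration hx (inv_mem ihx)

lemma inv_commutator_mem_commutatorFiltration [Group.IsNilpotent G] {V : Set G} {j : ℕ} {c g : G}
    (hc : c ∈ simpleCommutators V j) (hg : g ∈ Subgroup.closure V) :
    c⁻¹⁻¹ * g⁻¹ * c⁻¹ * g ∈ commutatorFiltration V (j + 1) := by
  have e : c⁻¹⁻¹ * g⁻¹ * c⁻¹ * g = c * (c⁻¹ * g⁻¹ * c * g)⁻¹ * c⁻¹ := by group
  rw [e]
  exact conj_mem_commutatorFiltration (simpleCommutators_subset_closure V j hc)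
    (inv_mem (commutator_mem_commutatorFiltration hc hg))

/-! ### Common right multiples in the monoid generated by `V` -/

lemma submonoidClosure_le_closure (V : Set G) {m : G} (hm : m ∈ Submonoid.closure V) :
    m ∈ Subgroup.closure V :=
  (Submonoid.closure_le (S := (Subgroup.closure V).toSubmonoid)).2 Subgroup.subset_closure hm

/-- The Ore condition. If `A = a * u` and `B = b * v` differ by `c = B⁻¹ * A`, then `A * B` and `B *
A` differ by the commutator of `c` with `B`, one step deeper in the lower central series; nilpotency
ends the process. -/
lemma exists_common_right_multiple [Group.IsNilpotent G] (M : Submonoid G) {a b : G}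
    (ha : a ∈ M) (hb : b ∈ M) : ∃ u ∈ M, ∃ v ∈ M, a * u = b * v := by
  have key : ∀ n, ∃ u ∈ M, ∃ v ∈ M,
      (b * v)⁻¹ * (a * u) ∈ (⊤ : Subgroup G).lowerCentralSeries n := by
    intro n
    induction n with
    | zero => exact ⟨1, one_mem M, 1, one_mem M, Subgroup.mem_top _⟩
    | succ n ih =>
      obtain ⟨u, hu, v, hv, h⟩ := ih
      refine ⟨u * (b * v), mul_mem hu (mul_mem hb hv), v * (a * u), mul_mem hv (mul_mem ha hu), ?_⟩
      have := commutator_mem_lowerCentralSeries_succ h (b * v)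
      have e : (b * (v * (a * u)))⁻¹ * (a * (u * (b * v))) =
        ((b * v)⁻¹ * (a * u))⁻¹ * (b * v)⁻¹ * ((b * v)⁻¹ * (a * u)) * (b * v) := by group
      rwa [e]
  obtain ⟨n, hn⟩ := Subgroup.nilpotent_iff_lowerCentralSeries.1 (inferInstance : Group.IsNilpotent G)
  obtain ⟨u, hu, v, hv, h⟩ := key n
  rw [hn, Subgroup.mem_bot] at h
  exact ⟨u, hu, v, hv, (inv_mul_eq_one.1 h).symm⟩

lemma exists_mul_eq_of_mem_closure [Group.IsNilpotent G] {V : Set G} {g : G}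
    (hg : g ∈ Subgroup.closure V) :
    ∃ x ∈ Submonoid.closure V, ∃ y ∈ Submonoid.closure V, g * x = y := by
  induction hg using Subgroup.closure_induction with
  | mem s hs => exact ⟨1, one_mem _, s, Submonoid.subset_closure hs, mul_one s⟩
  | one => exact ⟨1, one_mem _, 1, one_mem _, mul_one 1⟩
  | mul a b _ _ iha ihb =>
    obtain ⟨x, hx, y, hy, e⟩ := iha
    obtain ⟨x', hx', y', hy', e'⟩ := ihb
    obtain ⟨u, hu, v, hv, h⟩ := exists_common_right_multiple _ hy' hx
    refine ⟨x' * u, mul_mem hx' hu, y * v, mul_mem hy hv, ?_⟩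
    rw [mul_assoc, ← mul_assoc b, e', h, ← mul_assoc, e]
  | inv a _ iha =>
    obtain ⟨x, hx, y, hy, e⟩ := iha
    exact ⟨y, hy, x, hx, by rw [← e, inv_mul_cancel_left]⟩

/-- Nilpotency leaves only finitely many simple commutators, so suitable words for all of them can
be concatenated. -/
lemma exists_isFacetWord [Group.IsNilpotent G] {V : Set G} (hV : V.Finite) :
    ∃ w : List G, IsFacetWord V w := by
  have key : ∀ c : G, ∃ x y : List G, IsSimpleCommutator V c →
      (∀ s ∈ x, s ∈ V) ∧ (∀ s ∈ y, s ∈ V) ∧ c * x.prod = y.prod := by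
    intro c
    by_cases hc : IsSimpleCommutator V c
    · obtain ⟨k, hk⟩ := hc.exists_weight
      obtain ⟨x, hx, y, hy, e⟩ := exists_mul_eq_of_mem_closure
        (simpleCommutators_subset_closure V k hk)
      obtain ⟨lx, hlx, rfl⟩ := Submonoid.exists_list_of_mem_closure hx
      obtain ⟨ly, hly, rfl⟩ := Submonoid.exists_list_of_mem_closure hy
      exact ⟨lx, ly, fun _ => ⟨hlx, hly, e⟩⟩
    · exact ⟨[], [], fun h => absurd h hc⟩
  choose x y hxy using key
  have hfin := finite_isSimpleCommutator hV
  refine ⟨hfin.toFinset.toList.flatMap fun c => x c ++ y c, ?_, fun c hc => ?_⟩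
  · intro s hs
    simp only [List.mem_flatMap, Finset.mem_toList, Set.Finite.mem_toFinset, Set.mem_ofPred_eq,
      List.mem_append] at hs
    obtain ⟨c, hc, h | h⟩ := hs
    · exact (hxy c hc).1 s h
    · exact (hxy c hc).2.1 s h
  · refine ⟨x c, y c, (hxy c hc).1, (hxy c hc).2.1, (hxy c hc).2.2, ?_⟩
    have hmem : c ∈ hfin.toFinset.toList := by simpa using hc
    obtain ⟨l₁, l₂, h⟩ := List.append_of_mem hmem
    rw [h, List.flatMap_append, List.flatMap_cons]
    exact ⟨⟨l₁.flatMap fun c => x c ++ y c, y c ++ l₂.flatMap fun c => x c ++ y c, by simp⟩,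
      ⟨l₁.flatMap (fun c => x c ++ y c) ++ x c, l₂.flatMap fun c => x c ++ y c, by simp⟩⟩

/-! ### Powers of an admissible word absorb the group generated by `V` -/

/-- Push `d` to the right past `m` and `α` until it meets `x` and turns it into `y`. The commutators
this creates are conjugated to the right of `β`; they lie in a deeper level `k`, where `hN` lets
further powers absorb them. -/
lemma mul_mul_pow_mem [Group.IsNilpotent G] {V : Set G} {k : ℕ} {d α x β y : G}
    (hd : ∀ g ∈ Subgroup.closure V, d⁻¹ * g⁻¹ * d * g ∈ commutatorFiltration V k)
    (hα : α ∈ Submonoid.closure V) (hx : x ∈ Submonoid.closure V)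
    (hβ : β ∈ Submonoid.closure V) (hy : y ∈ Submonoid.closure V) (hdx : d * x = y)
    (hN : ∀ h ∈ commutatorFiltration V k, ∃ p : ℕ, h * (α * x * β) ^ p ∈ Submonoid.closure V)
    {m : G} (hm : m ∈ Submonoid.closure V) :
    ∃ p : ℕ, d * m * (α * x * β) ^ p ∈ Submonoid.closure V := by
  have hH := fun {m : G} (hm : m ∈ Submonoid.closure V) => submonoidClosure_le_closure V hm
  have h1 := conj_mem_commutatorFiltration' (hH (mul_mem (mul_mem hα hx) hβ)) (hd m (hH hm))
  have h2 := conj_mem_commutatorFiltration' (hH (mul_mem hx hβ)) (hd α (hH hα))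
  obtain ⟨p, hp⟩ := hN _ (mul_mem h2 h1)
  refine ⟨p + 1, ?_⟩
  have e : d * m * (α * x * β) ^ (p + 1) = m * (α * y * β) *
      ((x * β)⁻¹ * (d⁻¹ * α⁻¹ * d * α) * (x * β) *
        ((α * x * β)⁻¹ * (d⁻¹ * m⁻¹ * d * m) * (α * x * β)) * (α * x * β) ^ p) := by
    rw [pow_succ', ← hdx]
    generalize (α * x * β) ^ p = W
    group
  rw [e]
  exact mul_mem (mul_mem hm (mul_mem (mul_mem hα hy) hβ)) hp

lemma list_prod_mem_closure {V : Set G} {w : List G} (hw : ∀ s ∈ w, s ∈ V) :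
    w.prod ∈ Submonoid.closure V :=
  list_prod_mem fun s hs => Submonoid.subset_closure (hw s hs)

lemma exists_factorization_of_infix {V : Set G} {w x : List G} (hw : ∀ s ∈ w, s ∈ V)
    (hx : x <:+: w) : ∃ α ∈ Submonoid.closure V, ∃ β ∈ Submonoid.closure V,
      w.prod = α * x.prod * β := by
  obtain ⟨s, t, rfl⟩ := hx
  exact ⟨s.prod, list_prod_mem_closure fun a ha => hw a (by simp [ha]), t.prod,
    list_prod_mem_closure fun a ha => hw a (by simp [ha]), by simp [List.prod_append, mul_assoc]⟩

lemma IsFacetWord.exists_mul_pow_mem_filtration [Group.IsNilpotent G] {V : Set G} {w : List G}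
    (hw : IsFacetWord V w) (k : ℕ) {g : G} (hg : g ∈ commutatorFiltration V k) :
    ∃ p : ℕ, g * w.prod ^ p ∈ Submonoid.closure V := by
  obtain ⟨n, hn⟩ := commutatorFiltration_eq_bot V
  have key : ∀ i k, n ≤ k + i → ∀ g ∈ commutatorFiltration V k,
      ∃ p : ℕ, g * w.prod ^ p ∈ Submonoid.closure V := by
    intro i
    induction i with
    | zero =>
      intro k hk g hg
      have := commutatorFiltration_antitone V hk hg
      rw [hn, Subgroup.mem_bot] at this
      exact ⟨0, by simp [this]⟩
    | succ i ih =>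
      intro k hk g hg
      have step : ∀ c, (∃ j, k ≤ j ∧ c ∈ simpleCommutators V j) →
          ∀ m ∈ Submonoid.closure V, (∃ p : ℕ, c * m * w.prod ^ p ∈ Submonoid.closure V) ∧
            ∃ p : ℕ, c⁻¹ * m * w.prod ^ p ∈ Submonoid.closure V := by
        rintro c ⟨j, hj, hc⟩ m hm
        obtain ⟨x, y, hx, hy, e, hxw, hyw⟩ := hw.2 c (isSimpleCommutator_of_mem hc)
        -- Commutators with `c` lie in level `j + 1 > k`, which the descending induction has already
        -- handled.
        have hN := ih (j + 1) (by omega)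
        constructor
        · obtain ⟨α, hα, β, hβ, he⟩ := exists_factorization_of_infix hw.1 hxw
          rw [he] at hN ⊢
          exact mul_mul_pow_mem (fun g hg => commutator_mem_commutatorFiltration hc hg) hα
            (list_prod_mem_closure hx) hβ (list_prod_mem_closure hy) e hN hm
        -- For `c⁻¹` the relation reads `c⁻¹ * y = x`, so here `y` must be the subword of `w`.
        · obtain ⟨α, hα, β, hβ, he⟩ := exists_factorization_of_infix hw.1 hyw
          rw [he] at hN ⊢
          exact mul_mul_pow_mem (fun g hg => inv_commutator_mem_commutatorFiltration hc hg) hα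
            (list_prod_mem_closure hy) hβ (list_prod_mem_closure hx)
            (by rw [← e, inv_mul_cancel_left]) hN hm
      induction hg using Subgroup.closure_induction_left with
      | one => exact ⟨0, by simp⟩
      | mul_left c hc y _ ihy =>
        obtain ⟨p, hp⟩ := ihy
        obtain ⟨q, hq⟩ := (step c hc _ hp).1
        exact ⟨p + q, by rwa [pow_add, ← mul_assoc, mul_assoc c]⟩
      | inv_mul_cancel c hc y _ ihy =>
        obtain ⟨p, hp⟩ := ihy
        obtain ⟨q, hq⟩ := (step c hc _ hp).2
        exact ⟨p + q, by rwa [pow_add, ← mul_assoc, mul_assoc c⁻¹]⟩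
  exact key n k (by omega) g hg

lemma IsFacetWord.exists_mul_pow_mem [Group.IsNilpotent G] {V : Set G} {w : List G}
    (hw : IsFacetWord V w) {g : G} (hg : g ∈ Subgroup.closure V) :
    ∃ p : ℕ, ∀ q, p ≤ q → g * w.prod ^ q ∈ Submonoid.closure V := by
  have h0 : Subgroup.closure V ≤ commutatorFiltration V 0 :=
    Subgroup.closure_mono fun s hs => ⟨0, le_rfl, hs⟩
  obtain ⟨p, hp⟩ := hw.exists_mul_pow_mem_filtration 0 (h0 hg)
  refine ⟨p, fun q hq => ?_⟩
  obtain ⟨r, rfl⟩ := Nat.exists_eq_add_of_le hq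
  rw [pow_add, ← mul_assoc]
  exact mul_mem hp (pow_mem (list_prod_mem_closure hw.1) r)

/-- Needed because the empty word gives the constant path at `1`, which is not geodesic. -/
lemma IsFacetWord.ne_nil {V : Set G} {w : List G} (hw : IsFacetWord V w)
    (hV : V.Nonempty) (hV1 : (1 : G) ∉ V) : w ≠ [] := by
  rintro rfl
  obtain ⟨s, hs⟩ := hV
  obtain ⟨x, y, -, -, e, hx, hy⟩ := hw.2 s (.base s hs)
  rw [List.infix_nil] at hx hy
  subst hx hy
  simp only [List.prod_nil, mul_one] at e
  exact hV1 (e ▸ hs)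

end Commutators

/-! ### Periodic paths -/

section Periodic

variable {G : Type*} [Group G]

lemma periodicPath_zero (w : List G) : periodicPath w 0 = 1 := by
  simp [periodicPath]

lemma periodicPath_succ (w : List G) (n : ℕ) :
    periodicPath w (n + 1) = periodicPath w n * w.getD (n % w.length) 1 := by
  simp [periodicPath, List.range_succ]

lemma periodicPath_length (w : List G) : periodicPath w w.length = w.prod := by
  rw [periodicPath]
  congr 1
  refine List.ext_getElem (by simp) fun i h1 h2 => ?_
  simp [Nat.mod_eq_of_lt h2, h2]

lemma periodicPath_length_add (w : List G) (n : ℕ) :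
    periodicPath w (w.length + n) = w.prod * periodicPath w n := by
  induction n with
  | zero => rw [add_zero, periodicPath_length, periodicPath_zero, mul_one]
  | succ n ih => rw [← add_assoc, periodicPath_succ, ih, periodicPath_succ, Nat.add_mod_left, mul_assoc]

lemma periodicPath_length_mul (w : List G) (k : ℕ) :
    periodicPath w (k * w.length) = w.prod ^ k := by
  induction k with
  | zero => simp [periodicPath_zero]
  | succ k ih => rw [Nat.succ_mul, add_comm, periodicPath_length_add, ih, pow_succ']

lemma periodicPath_step_mem {V : Set G} {w : List G} (hw : ∀ s ∈ w, s ∈ V) (h0 : w ≠ []) (n : ℕ) :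
    (periodicPath w n)⁻¹ * periodicPath w (n + 1) ∈ V := by
  rw [periodicPath_succ, inv_mul_cancel_left]
  have : n % w.length < w.length := Nat.mod_lt _ (List.length_pos_iff.2 h0)
  rw [List.getD_eq_getElem _ _ this]
  exact hw _ (List.getElem_mem _)

lemma mem_closure_of_steps {V : Set G} {γ : ℕ → G} (h : ∀ n, (γ n)⁻¹ * γ (n + 1) ∈ V)
    {m n : ℕ} (hmn : m ≤ n) : (γ m)⁻¹ * γ n ∈ Submonoid.closure V := by
  induction n, hmn using Nat.le_induction with
  | base => simp
  | succ n _ ih =>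
    have e : (γ m)⁻¹ * γ (n + 1) = ((γ m)⁻¹ * γ n) * ((γ n)⁻¹ * γ (n + 1)) := by group
    rw [e]
    exact mul_mem ih (Submonoid.subset_closure (h n))

variable {S : Set G} {L : G → ℝ}

lemma additive_of_steps (hL : ∀ a b, L (a * b) = L a + L b) {γ : ℕ → G}
    (h : ∀ n, L ((γ n)⁻¹ * γ (n + 1)) = 1) (n : ℕ) : L (γ n) = L (γ 0) + n := by
  induction n with
  | zero => simp
  | succ n ih =>
    have := h n
    rw [hL, additive_inv hL] at this
    push_cast
    linarith

lemma isGeodesicPath_of_steps (hgen : Subgroup.closure S = ⊤) (hsymm : ∀ s ∈ S, s⁻¹ ∈ S)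
    (hL : ∀ a b, L (a * b) = L a + L b) (hS : ∀ s ∈ S, L s ≤ 1) {γ : ℕ → G}
    (h : ∀ n, (γ n)⁻¹ * γ (n + 1) ∈ {s | s ∈ S ∧ L s = 1}) : IsGeodesicPath S γ := by
  have hadd := additive_of_steps hL fun n => (h n).2
  have key : ∀ m n : ℕ, m ≤ n → (wordDist S (γ m) (γ n) : ℝ) = n - m := by
    intro m n hmn
    rw [wordDist_eq_additive hgen hsymm hL hS (mem_closure_of_steps h hmn), hL,
      additive_inv hL, hadd m, hadd n]
    ring
  intro m n
  rcases le_total m n with hmn | hmn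
  · have := key m n hmn
    rw [abs_sub_comm, abs_of_nonneg (sub_nonneg.2 (by exact_mod_cast hmn))]
    exact_mod_cast this
  · have := key n m hmn
    rw [wordDist_comm, abs_of_nonneg (sub_nonneg.2 (by exact_mod_cast hmn))]
    exact_mod_cast this

end Periodic

/-! ### Horofunctions with a finite orbit -/

section FiniteOrbit

variable {G : Type*} [Group G]

instance horoOrbitMulAction (ξ : G → ℝ) : MulAction G (horoOrbit ξ) where
  smul g η := ⟨horoAct g η.1, by
    obtain ⟨_, h, rfl⟩ := η
    exact ⟨g * h, horoAct_mul g h ξ⟩⟩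
  one_smul η := by
    obtain ⟨_, h, rfl⟩ := η
    exact Subtype.ext (horoAct_one (horoAct_apply_one h ξ))
  mul_smul g h η := Subtype.ext (horoAct_mul g h η.1)

/-- The elements of `G` fixing every point of the orbit of `ξ`. -/
def orbitKernel (ξ : G → ℝ) : Subgroup G :=
  (MulAction.toPermHom G (horoOrbit ξ)).ker

instance orbitKernel_normal (ξ : G → ℝ) : (orbitKernel ξ).Normal := by
  unfold orbitKernel; infer_instance

lemma orbitKernel_finiteIndex {ξ : G → ℝ} (hfin : (horoOrbit ξ).Finite) :
    (orbitKernel ξ).FiniteIndex := by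
  have : Finite (horoOrbit ξ) := hfin
  unfold orbitKernel; infer_instance

lemma horoAct_of_mem_orbitKernel {ξ : G → ℝ} (h1 : ξ 1 = 0) {k : G} (hk : k ∈ orbitKernel ξ) :
    horoAct k ξ = ξ := by
  have h := DFunLike.congr_fun (MonoidHom.mem_ker.1 hk) ⟨ξ, 1, horoAct_one h1⟩
  exact congrArg Subtype.val h

/-- This is the invariance of `ξ` under `k⁻¹`. It gives additivity only when the left factor lies in
the kernel. -/
lemma apply_mul_of_mem_orbitKernel {ξ : G → ℝ} (h1 : ξ 1 = 0) {k : G} (hk : k ∈ orbitKernel ξ)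
    (x : G) : ξ (k * x) = ξ k + ξ x := by
  have := congrFun (horoAct_of_mem_orbitKernel h1 (inv_mem hk)) x
  rw [horoAct, inv_inv] at this
  linarith

lemma apply_inv_of_mem_orbitKernel {ξ : G → ℝ} (h1 : ξ 1 = 0) {k : G} (hk : k ∈ orbitKernel ξ) :
    ξ k⁻¹ = -ξ k := by
  have := apply_mul_of_mem_orbitKernel h1 hk k⁻¹
  rw [mul_inv_cancel, h1] at this
  linarith

lemma conj_mem_orbitKernel {ξ : G → ℝ} {k : G} (hk : k ∈ orbitKernel ξ) (g : G) :
    g⁻¹ * k * g ∈ orbitKernel ξ := by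
  simpa using (orbitKernel_normal ξ).conj_mem k hk g⁻¹

lemma horoAct_apply_of_mem_orbitKernel {ξ : G → ℝ} (h1 : ξ 1 = 0) {k : G}
    (hk : k ∈ orbitKernel ξ) (g : G) : horoAct g ξ k = ξ (g⁻¹ * k * g) := by
  have := apply_mul_of_mem_orbitKernel h1 (conj_mem_orbitKernel hk g) g⁻¹
  rw [mul_inv_cancel_right] at this
  rw [horoAct, this]
  ring

lemma exists_bound_conj {ξ : G → ℝ} (h1 : ξ 1 = 0) (hfin : (horoOrbit ξ).Finite) {k : G}
    (hk : k ∈ orbitKernel ξ) : ∃ B : ℝ, ∀ g : G, |ξ (g⁻¹ * k * g)| ≤ B := by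
  obtain ⟨B, hB⟩ := (hfin.image fun η => |η k|).bddAbove
  refine ⟨B, fun g => ?_⟩
  rw [← horoAct_apply_of_mem_orbitKernel h1 hk]
  exact hB ⟨horoAct g ξ, ⟨g, rfl⟩, rfl⟩

lemma eq_zero_of_natCast_mul_bounded {a δ B : ℝ} (h : ∀ n : ℕ, |a + n * δ| ≤ B) : δ = 0 := by
  by_contra hδ
  obtain ⟨n, hn⟩ := exists_nat_gt ((B + |a|) / |δ|)
  rw [div_lt_iff₀ (abs_pos.2 hδ)] at hn
  have h2 : |(n : ℝ) * δ| ≤ |a + n * δ| + |a| := by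
    have := abs_sub (a + n * δ) a
    rwa [add_sub_cancel_left] at this
  rw [abs_mul, Nat.abs_cast] at h2
  linarith [h n]

/-- Induction along the upper central series: the commutator of `k` with `t` lies one term lower, so
by induction `ξ` takes the same value on its conjugates. Conjugating `k` by `t ^ j` therefore
changes `ξ` by `j` times that value, and boundedness forces the value to be zero. -/
lemma apply_conj_of_mem_orbitKernel [Group.IsNilpotent G] {ξ : G → ℝ} (h1 : ξ 1 = 0)
    (hfin : (horoOrbit ξ).Finite) {k : G} (hk : k ∈ orbitKernel ξ) (t : G) :
    ξ (t⁻¹ * k * t) = ξ k := by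
  have key : ∀ n, ∀ k ∈ orbitKernel ξ, k ∈ Subgroup.upperCentralSeries G n →
      ∀ t, ξ (t⁻¹ * k * t) = ξ k := by
    intro n
    induction n with
    | zero =>
      intro k _ hk t
      rw [Subgroup.upperCentralSeries_zero, Subgroup.mem_bot] at hk
      simp [hk]
    | succ n ih =>
      intro k hk hkn t
      have hc : k⁻¹ * (t⁻¹ * k * t) ∈ Subgroup.upperCentralSeries G n := by
        have := Subgroup.mem_upperCentralSeries_succ_iff.1 (inv_mem hkn) t⁻¹
        rw [commutatorElement_def] at this
        simpa [mul_assoc] using this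
      have hcK : k⁻¹ * (t⁻¹ * k * t) ∈ orbitKernel ξ :=
        mul_mem (inv_mem hk) (conj_mem_orbitKernel hk t)
      have hstep : ∀ j : ℕ, ξ ((t ^ j)⁻¹ * k * t ^ j) = ξ k + j * ξ (k⁻¹ * (t⁻¹ * k * t)) := by
        intro j
        induction j with
        | zero => simp
        | succ j ihj =>
          have e : (t ^ (j + 1))⁻¹ * k * t ^ (j + 1) = ((t ^ j)⁻¹ * k * t ^ j) *
              ((t ^ j)⁻¹ * (k⁻¹ * (t⁻¹ * k * t)) * t ^ j) := by
            rw [pow_succ']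
            generalize t ^ j = p
            group
          rw [e, apply_mul_of_mem_orbitKernel h1 (conj_mem_orbitKernel hk _), ihj, ih _ hcK hc]
          push_cast
          ring
      obtain ⟨B, hB⟩ := exists_bound_conj h1 hfin hk
      have h0 := eq_zero_of_natCast_mul_bounded fun j => (hstep j) ▸ hB (t ^ j)
      have := hstep 1
      rw [pow_one, h0] at this
      simpa using this
  obtain ⟨n, hn⟩ := Group.IsNilpotent.nilpotent G
  exact key n k hk (hn ▸ Subgroup.mem_top k) t

/-- A nilpotent group has a homomorphism to `ℝ` at bounded distance from the negative of a
horofunction with finite orbit, namely the negative of the average over the orbit. -/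
lemma exists_additive_near_horofunction [Group.IsNilpotent G] {S : Set G}
    (hgen : Subgroup.closure S = ⊤) (hsymm : ∀ s ∈ S, s⁻¹ ∈ S) {γ : ℕ → G} {ξ : G → ℝ}
    (hξ : ConvergesTo S γ ξ) (hfin : (horoOrbit ξ).Finite) :
    ∃ L : G → ℝ, (∀ a b, L (a * b) = L a + L b) ∧ (∀ s ∈ S, L s ≤ 1) ∧
      ∃ C : ℝ, ∀ g, |L g + ξ g| ≤ C := by
  have h1 := hξ.apply_one
  have := hfin.fintype
  have hne : Nonempty (horoOrbit ξ) := ⟨⟨ξ, 1, horoAct_one h1⟩⟩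
  have hr : (0 : ℝ) < Fintype.card (horoOrbit ξ) := by exact_mod_cast Fintype.card_pos
  let σ : G → ℝ := fun x => ∑ η : horoOrbit ξ, (η : G → ℝ) x
  have hσ : ∀ a b, σ (a * b) = σ a + σ b := by
    intro a b
    -- Translation by `a⁻¹` permutes the orbit, and `horoAct a⁻¹ η b = η (a * b) - η a`.
    have e1 : σ b = ∑ η : horoOrbit ξ, horoAct a⁻¹ (η : G → ℝ) b :=
      (Equiv.sum_comp (MulAction.toPerm (a⁻¹ : G)) fun η : horoOrbit ξ => (η : G → ℝ) b).symm
    rw [e1, ← Finset.sum_add_distrib]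
    refine Finset.sum_congr rfl fun η _ => ?_
    simp only [horoAct, inv_inv]
    ring
  have hσK : ∀ k ∈ orbitKernel ξ, σ k = Fintype.card (horoOrbit ξ) * ξ k := by
    intro k hk
    have : ∀ η : horoOrbit ξ, (η : G → ℝ) k = ξ k := by
      rintro ⟨_, g, rfl⟩
      exact (horoAct_apply_of_mem_orbitKernel h1 hk g).trans
        (apply_conj_of_mem_orbitKernel h1 hfin hk g)
    simp [σ, this]
  have hσS : ∀ s ∈ S, -σ s ≤ Fintype.card (horoOrbit ξ) := by
    intro s hs
    have : ∀ η : horoOrbit ξ, -(η : G → ℝ) s ≤ 1 := by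
      rintro ⟨_, g, rfl⟩
      have h2 := hξ.sub_le hgen hsymm g⁻¹ (g⁻¹ * s)
      have h3 : (wordDist S g⁻¹ (g⁻¹ * s) : ℝ) ≤ 1 := by
        exact_mod_cast wordDist_mul_right_le_one hsymm hs g⁻¹
      simp only [horoAct]
      linarith
    have h2 := Finset.sum_le_sum fun (η : horoOrbit ξ) (_ : η ∈ Finset.univ) => this η
    simpa [σ] using h2
  refine ⟨fun g => -σ g / Fintype.card (horoOrbit ξ), fun a b => ?_, fun s hs => ?_, ?_⟩
  · dsimp only
    rw [hσ]; ring
  · exact (div_le_one hr).2 (hσS s hs)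
  · have hK := orbitKernel_finiteIndex hfin
    -- This error depends only on the coset of the kernel, so it takes finitely many values.
    -- Normality is used to move the kernel element to the left of the representative `t`, where `ξ`
    -- is additive.
    let φ : G → ℝ := fun g => |-σ g / Fintype.card (horoOrbit ξ) + ξ g|
    obtain ⟨C, hC⟩ := (Set.finite_range fun q : G ⧸ orbitKernel ξ => φ q.out).bddAbove
    refine ⟨C, fun g => ?_⟩
    have hq : ((g : G ⧸ orbitKernel ξ).out)⁻¹ * g ∈ orbitKernel ξ :=
      QuotientGroup.eq.1 (QuotientGroup.out_eq' _)
    have hC' := hC ⟨(g : G ⧸ orbitKernel ξ), rfl⟩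
    set t := (g : G ⧸ orbitKernel ξ).out
    have hk : g * t⁻¹ ∈ orbitKernel ξ := by
      have := (orbitKernel_normal ξ).conj_mem _ hq t
      simpa [mul_assoc] using this
    have e1 : σ g = σ (g * t⁻¹) + σ t := by rw [← hσ, inv_mul_cancel_right]
    have e2 : ξ g = ξ (g * t⁻¹) + ξ t := by
      rw [← apply_mul_of_mem_orbitKernel h1 hk, inv_mul_cancel_right]
    have e3 : -σ g / Fintype.card (horoOrbit ξ) + ξ g =
        -σ t / Fintype.card (horoOrbit ξ) + ξ t := by
      rw [e1, e2, hσK _ hk]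
      field_simp
      ring
    rw [e3]
    exact hC'

/-! ### Directions of geodesic paths -/

lemma IsGeodesicPath.step_mem {S : Set G} (hsymm : ∀ s ∈ S, s⁻¹ ∈ S) {γ : ℕ → G}
    (hγ : IsGeodesicPath S γ) (n : ℕ) : (γ n)⁻¹ * γ (n + 1) ∈ S := by
  refine mem_of_wordDist_eq_one hsymm ?_
  have := hγ.wordDist_of_le (Nat.le_succ n)
  push_cast at this
  lia

lemma direction_subset {S : Set G} (hsymm : ∀ s ∈ S, s⁻¹ ∈ S) {γ : ℕ → G}
    (hγ : IsGeodesicPath S γ) : direction γ ⊆ S := by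
  intro s hs
  obtain ⟨n, hn⟩ := Frequently.exists hs
  exact hn ▸ hγ.step_mem hsymm n

lemma eventually_step_mem_direction {S : Set G} (hS : S.Finite) (hsymm : ∀ s ∈ S, s⁻¹ ∈ S)
    {γ : ℕ → G} (hγ : IsGeodesicPath S γ) :
    ∀ᶠ n in atTop, (γ n)⁻¹ * γ (n + 1) ∈ direction γ := by
  have h : ∀ s ∈ S, ∀ᶠ n in atTop, (γ n)⁻¹ * γ (n + 1) = s → s ∈ direction γ := by
    intro s _
    by_cases hs : s ∈ direction γ
    · exact Eventually.of_forall fun _ _ => hs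
    · filter_upwards [not_frequently.1 hs] with n hn h
      exact absurd h hn
  filter_upwards [(eventually_all_finite hS).2 h] with n hn
  exact hn _ (hγ.step_mem hsymm n) rfl

lemma direction_nonempty {S : Set G} (hS : S.Finite) (hsymm : ∀ s ∈ S, s⁻¹ ∈ S)
    {γ : ℕ → G} (hγ : IsGeodesicPath S γ) : (direction γ).Nonempty := by
  obtain ⟨n, hn⟩ := (eventually_step_mem_direction hS hsymm hγ).exists
  exact ⟨_, hn⟩

/-- The deficit `n - L (γ n)` never decreases and grows by `1 - L s` at each occurrence of `s`;
being bounded, it leaves no room for `L s < 1`. -/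
lemma additive_eq_one_of_mem_direction {S : Set G} (hsymm : ∀ s ∈ S, s⁻¹ ∈ S) {γ : ℕ → G}
    (hγ : IsGeodesicPath S γ) {L : G → ℝ} (hL : ∀ a b, L (a * b) = L a + L b)
    (hS : ∀ s ∈ S, L s ≤ 1) {C : ℝ} (hC : ∀ n : ℕ, n - L (γ n) ≤ C) {s : G}
    (hs : s ∈ direction γ) : L s = 1 := by
  refine le_antisymm (hS s (direction_subset hsymm hγ hs)) ?_
  by_contra hlt
  have hstep : ∀ n, L (γ (n + 1)) = L (γ n) + L ((γ n)⁻¹ * γ (n + 1)) := by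
    intro n
    rw [← hL, mul_inv_cancel_left]
  have hmono : Monotone fun n : ℕ => (n : ℝ) - L (γ n) := by
    refine monotone_nat_of_le_succ fun n => ?_
    have := hS _ (hγ.step_mem hsymm n)
    rw [hstep]
    push_cast
    linarith
  have key : ∀ j : ℕ, ∃ n : ℕ, j * (1 - L s) - L (γ 0) ≤ n - L (γ n) := by
    intro j
    induction j with
    | zero => exact ⟨0, by simp⟩
    | succ j ih =>
      obtain ⟨n, hn⟩ := ih
      obtain ⟨m, hnm, hm⟩ := frequently_atTop.1 hs n
      refine ⟨m + 1, ?_⟩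
      have h1 := hmono hnm
      dsimp only at h1
      rw [hstep, hm]
      push_cast
      linarith
  obtain ⟨j, hj⟩ := exists_nat_gt ((C + L (γ 0)) / (1 - L s))
  rw [div_lt_iff₀ (by linarith)] at hj
  obtain ⟨n, hn⟩ := key j
  linarith [hC n]

lemma IsGeodesicPath.limit_apply_path {S : Set G} (hgen : Subgroup.closure S = ⊤)
    (hsymm : ∀ s ∈ S, s⁻¹ ∈ S) {γ : ℕ → G} (hγ : IsGeodesicPath S γ) (h0 : γ 0 = 1) {η : G → ℝ}
    (hη : ConvergesTo S γ η) (n : ℕ) : η (γ n) ≤ -n := by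
  have := hγ.limit_le hgen hsymm h0 hη (γ n) n
  rw [wordDist_self] at this
  simpa using this

/-- The direction of a geodesic converging to a point with finite orbit is contained in the set
where some homomorphism bounded by `1` on the generators attains the value `1`. -/
lemma exists_additive_eq_one_on_direction [Group.IsNilpotent G] {S : Set G}
    (hgen : Subgroup.closure S = ⊤) (hsymm : ∀ s ∈ S, s⁻¹ ∈ S) {γ : ℕ → G} {ξ : G → ℝ}
    (hγ : IsGeodesicPath S γ) (hξ : ConvergesTo S γ ξ) (hfin : (horoOrbit ξ).Finite) :
    ∃ L : G → ℝ, (∀ a b, L (a * b) = L a + L b) ∧ (∀ s ∈ S, L s ≤ 1) ∧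
      ∀ s ∈ direction γ, L s = 1 := by
  have hγ' := hγ.translate_tail hgen hsymm (γ 0)⁻¹ 0
  have hξ' := hξ.translate_tail hgen hsymm (γ 0)⁻¹ 0
  have h0 : (fun n => (γ 0)⁻¹ * γ (0 + n)) 0 = 1 := by simp
  obtain ⟨L, hL, hS, C, hC⟩ := exists_additive_near_horofunction hgen hsymm hξ'
    (by rwa [horoOrbit_horoAct])
  refine ⟨L, hL, hS, fun s hs => additive_eq_one_of_mem_direction hsymm hγ' hL hS (C := C)
    (fun n => ?_) ?_⟩
  · have h1 := (abs_le.1 (hC ((γ 0)⁻¹ * γ (0 + n)))).1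
    have h2 := hγ'.limit_apply_path hgen hsymm h0 hξ' n
    linarith
  · refine Frequently.mono hs fun n hn => ?_
    simpa [mul_assoc] using hn

end FiniteOrbit

/-! ### Facets of a polytope containing a given set of tight vertices -/

section Polytope

variable {E : Type*} [AddCommGroup E] [Module ℝ E]

/-- Move from `l` in the direction `h`, which keeps tight points tight, until the first new
constraint is hit. The critical parameter is the least ratio `(1 - l a) / h a` over points with `h a
> 0`. -/
lemma exists_more_tight {A : Set E} (hA : A.Finite) {l h : E →ₗ[ℝ] ℝ} (hl : ∀ a ∈ A, l a ≤ 1)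
    (hh : ∀ a ∈ A, l a = 1 → h a = 0) {b : E} (hb : b ∈ A) (hhb : 0 < h b) :
    ∃ l' : E →ₗ[ℝ] ℝ, (∀ a ∈ A, l' a ≤ 1) ∧ (∀ a ∈ A, l a = 1 → l' a = 1) ∧
      ∃ c ∈ A, l' c = 1 ∧ l c ≠ 1 := by
  obtain ⟨c, ⟨hc, hhc⟩, hmin⟩ := (hA.inter_of_left {a | 0 < h a}).exists_minimalFor
    (fun a => (1 - l a) / h a) _ ⟨b, hb, hhb⟩
  have hmin' : ∀ a ∈ A, 0 < h a → (1 - l c) / h c ≤ (1 - l a) / h a := by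
    intro a ha hha
    rcases le_total ((1 - l c) / h c) ((1 - l a) / h a) with h1 | h1
    · exact h1
    · exact hmin ⟨ha, hha⟩ h1
  have hhc' : 0 < h c := hhc
  have ht : 0 ≤ (1 - l c) / h c := div_nonneg (sub_nonneg.2 (hl c hc)) hhc'.le
  refine ⟨l + ((1 - l c) / h c) • h, fun a ha => ?_, fun a ha hla => ?_, c, hc, ?_, fun hlc => ?_⟩
  · rw [LinearMap.add_apply, LinearMap.smul_apply, smul_eq_mul]
    rcases le_or_gt (h a) 0 with h0 | h0
    · linarith [hl a ha, mul_nonpos_of_nonneg_of_nonpos ht h0]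
    · have := (le_div_iff₀ h0).1 (hmin' a ha h0)
      linarith
  · simp [hh a ha hla, hla]
  · rw [LinearMap.add_apply, LinearMap.smul_apply, smul_eq_mul, div_mul_cancel₀ _ hhc'.ne']
    ring
  · exact hhc'.ne' (hh c hc hlc)

/-- Take `l` with the largest number of tight points. If these failed to span, a nonzero functional
vanishing on them, with a suitable sign, would allow one more tight point. -/
lemma exists_tight_spanning {A : Set E} (hA : A.Finite) (hspan : Submodule.span ℝ A = ⊤)
    {l₀ : E →ₗ[ℝ] ℝ} (hl₀ : ∀ a ∈ A, l₀ a ≤ 1) :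
    ∃ l : E →ₗ[ℝ] ℝ, (∀ a ∈ A, l a ≤ 1) ∧ (∀ a ∈ A, l₀ a = 1 → l a = 1) ∧
      Submodule.span ℝ {a | a ∈ A ∧ l a = 1} = ⊤ := by
  have hfin : ∀ l : E →ₗ[ℝ] ℝ, {a | a ∈ A ∧ l a = 1}.Finite := fun l => hA.subset fun a ha => ha.1
  let T : Set ℕ := {n | ∃ l : E →ₗ[ℝ] ℝ, ((∀ a ∈ A, l a ≤ 1) ∧ ∀ a ∈ A, l₀ a = 1 → l a = 1) ∧
    {a | a ∈ A ∧ l a = 1}.ncard = n}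
  have hbdd : BddAbove T := ⟨A.ncard, by
    rintro _ ⟨l, -, rfl⟩
    exact Set.ncard_le_ncard (fun a ha => ha.1) hA⟩
  obtain ⟨l, ⟨hl, hl'⟩, hn⟩ : sSup T ∈ T :=
    Nat.sSup_mem ⟨_, l₀, ⟨hl₀, fun _ _ h => h⟩, rfl⟩ hbdd
  refine ⟨l, hl, hl', ?_⟩
  by_contra hne
  obtain ⟨h, hh0, hh⟩ := Submodule.exists_le_ker_of_lt_top _ (lt_top_iff_ne_top.2 hne)
  have hh' : ∀ a ∈ A, l a = 1 → h a = 0 := fun a ha hla => hh (Submodule.subset_span ⟨ha, hla⟩)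
  obtain ⟨b, hb, hhb⟩ : ∃ b ∈ A, h b ≠ 0 := by
    by_contra! hcon
    refine hh0 (LinearMap.ext_on hspan fun a ha => ?_)
    simpa using hcon a ha
  have key : ∃ l' : E →ₗ[ℝ] ℝ, (∀ a ∈ A, l' a ≤ 1) ∧ (∀ a ∈ A, l a = 1 → l' a = 1) ∧
      ∃ c ∈ A, l' c = 1 ∧ l c ≠ 1 := by
    rcases lt_or_gt_of_ne hhb with h1 | h1
    · exact exists_more_tight hA (h := -h) hl (fun a ha hla => by simp [hh' a ha hla]) hb
        (by simpa using h1)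
    · exact exists_more_tight hA hl hh' hb h1
  obtain ⟨l', h1, h2, c, hc, hc1, hc2⟩ := key
  have h3 : {a | a ∈ A ∧ l a = 1}.ncard < {a | a ∈ A ∧ l' a = 1}.ncard :=
    Set.ncard_lt_ncard ⟨fun a ha => ⟨ha.1, h2 a ha.1 ha.2⟩, fun h => hc2 (h ⟨hc, hc1⟩).2⟩ (hfin l')
  have h4 : {a | a ∈ A ∧ l' a = 1}.ncard ≤ sSup T :=
    le_csSup hbdd ⟨l', ⟨h1, fun a ha h => h2 a ha (hl' a ha h)⟩, rfl⟩
  omega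

lemma le_one_of_mem_convexHull {A : Set E} {l : E →ₗ[ℝ] ℝ} (hl : ∀ a ∈ A, l a ≤ 1) {x : E}
    (hx : x ∈ convexHull ℝ A) : l x ≤ 1 :=
  convexHull_min (fun a ha => hl a ha) (convex_halfSpace_le l.isLinear 1) hx

lemma isFacet_of_tight_spanning {N : ℕ} {A : Set (Fin N → ℝ)} (hneg : ∀ a ∈ A, -a ∈ A)
    {l : (Fin N → ℝ) →ₗ[ℝ] ℝ} (hl : ∀ a ∈ A, l a ≤ 1)
    (hspan : Submodule.span ℝ {a | a ∈ A ∧ l a = 1} = ⊤) (hne : ∃ a ∈ A, l a = 1) :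
    IsFacet (convexHull ℝ A) {x | x ∈ convexHull ℝ A ∧ l x = 1} := by
  obtain ⟨a₀, ha₀, hla₀⟩ := hne
  have hsub := subset_convexHull ℝ A
  have hmem : a₀ ∈ {x | x ∈ convexHull ℝ A ∧ l x = 1} := ⟨hsub ha₀, hla₀⟩
  refine ⟨⟨a₀, hmem⟩, fun _ => ⟨LinearMap.toContinuousLinearMap l, ?_⟩, ?_⟩
  · ext x
    simp only [LinearMap.coe_toContinuousLinearMap', Set.mem_ofPred_eq]
    refine and_congr_right fun hx => ⟨fun h y hy => h ▸ le_one_of_mem_convexHull hl hy,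
      fun h => le_antisymm (le_one_of_mem_convexHull hl hx) (hla₀ ▸ h a₀ (hsub ha₀))⟩
  -- By symmetry `A` contains both `a` and `-a`, so its differences include `2a`. The directions of
  -- the face, complemented by the line through `a₀`, then fill the space.
  · have hP : vectorSpan ℝ (convexHull ℝ A) = ⊤ := by
      rw [eq_top_iff, ← hspan, Submodule.span_le]
      rintro a ⟨ha, -⟩
      have h1 : a - -a ∈ vectorSpan ℝ (convexHull ℝ A) :=
        vsub_mem_vectorSpan ℝ (hsub ha) (hsub (hneg a ha))
      have h2 : a = (2⁻¹ : ℝ) • (a - -a) := by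
        rw [sub_neg_eq_add, ← two_smul ℝ a, smul_smul]; norm_num
      rw [h2]
      exact Submodule.smul_mem _ _ h1
    set F := {x | x ∈ convexHull ℝ A ∧ l x = 1}
    have hker : vectorSpan ℝ F ≤ LinearMap.ker l := by
      rw [vectorSpan_def, Submodule.span_le]
      rintro _ ⟨x, hx, y, hy, rfl⟩
      simp [hx.2, hy.2]
    have hcompl : IsCompl (vectorSpan ℝ F) (Submodule.span ℝ {a₀}) := by
      refine ⟨Submodule.disjoint_def.2 fun x hx hx' => ?_, codisjoint_iff.2 ?_⟩
      · obtain ⟨c, rfl⟩ := Submodule.mem_span_singleton.1 hx'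
        have := hker hx
        rw [LinearMap.mem_ker, map_smul, hla₀, smul_eq_mul, mul_one] at this
        rw [this, zero_smul]
      · rw [eq_top_iff, ← hspan, Submodule.span_le]
        rintro a ⟨ha, hla⟩
        have h1 : a - a₀ ∈ vectorSpan ℝ F := vsub_mem_vectorSpan ℝ ⟨hsub ha, hla⟩ hmem
        rw [← sub_add_cancel a a₀]
        exact Submodule.add_mem_sup h1 (Submodule.mem_span_singleton_self a₀)
    have h0 : a₀ ≠ 0 := by
      rintro rfl
      simp at hla₀
    rw [hP, finrank_top, ← Submodule.finrank_add_eq_of_isCompl hcompl, finrank_span_singleton h0]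

end Polytope

/-! ### The projection to the free part of the abelianisation -/

section Projection

variable {G : Type*} [Group G] {N : ℕ} (e : FreeAb G ≃* Multiplicative (Fin N → ℤ))

lemma phi_mul (a b : G) : phi e (a * b) = phi e a + phi e b := by
  funext i
  simp [phi]

lemma phi_one : phi e 1 = 0 := by
  have := phi_mul e 1 1
  rw [mul_one] at this
  simpa using this

lemma phi_inv (a : G) : phi e a⁻¹ = -phi e a := by
  have := phi_mul e a a⁻¹
  rw [mul_inv_cancel, phi_one] at this
  exact (neg_eq_of_add_eq_zero_right this.symm).symm

lemma exists_phi_eq (v : Fin N → ℤ) : ∃ g : G, phi e g = fun i => (v i : ℝ) := by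
  obtain ⟨q, hq⟩ := e.surjective (Multiplicative.ofAdd v)
  obtain ⟨a, rfl⟩ := QuotientGroup.mk_surjective q
  obtain ⟨g, rfl⟩ := QuotientGroup.mk_surjective a
  refine ⟨g, ?_⟩
  funext i
  have : e (QuotientGroup.mk (Abelianization.of g)) = Multiplicative.ofAdd v := hq
  simp [phi, this]

lemma span_range_phi : Submodule.span ℝ (Set.range (phi e)) = ⊤ := by
  rw [eq_top_iff, ← (Pi.basisFun ℝ (Fin N)).span_eq, Submodule.span_le]
  rintro _ ⟨i, rfl⟩
  obtain ⟨g, hg⟩ := exists_phi_eq e (Pi.single i 1)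
  refine Submodule.subset_span ⟨g, ?_⟩
  rw [hg]
  funext j
  by_cases h : j = i
  · subst h; simp
  · simp [h]

lemma span_phi_image {S : Set G} (hgen : Subgroup.closure S = ⊤) :
    Submodule.span ℝ (phi e '' S) = ⊤ := by
  rw [eq_top_iff, ← span_range_phi e, Submodule.span_le]
  rintro _ ⟨g, rfl⟩
  have hg : g ∈ Subgroup.closure S := hgen ▸ Subgroup.mem_top g
  induction hg using Subgroup.closure_induction with
  | mem x hx => exact Submodule.subset_span ⟨x, hx, rfl⟩
  | one => rw [phi_one]; exact Submodule.zero_mem _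
  | mul x y _ _ hx hy => rw [phi_mul]; exact Submodule.add_mem _ hx hy
  | inv x _ hx => rw [phi_inv]; exact Submodule.neg_mem _ hx

/-- Every homomorphism to `ℝ` factors linearly through the projection `phi e`. -/
lemma exists_linear_of_additive {L : G → ℝ} (hL : ∀ a b, L (a * b) = L a + L b) :
    ∃ l : (Fin N → ℝ) →ₗ[ℝ] ℝ, ∀ g, l (phi e g) = L g := by
  let f : G →* Multiplicative ℝ :=
    { toFun := fun g => Multiplicative.ofAdd (L g)
      map_one' := by rw [additive_one hL]; rfl
      map_mul' := fun a b => by rw [hL]; rfl }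
  -- A homomorphism to `ℝ` kills torsion.
  have htors : CommGroup.torsion (Abelianization G) ≤ (Abelianization.lift f).ker := by
    intro x hx
    obtain ⟨n, hn, hxn⟩ := isOfFinOrder_iff_pow_eq_one.1 hx
    have h1 : Abelianization.lift f x ^ n = 1 := by rw [← map_pow, hxn, map_one]
    have h2 : n • Multiplicative.toAdd (Abelianization.lift f x) = 0 := h1
    rw [nsmul_eq_mul, mul_eq_zero] at h2
    rcases h2 with h2 | h2
    · exact absurd (Nat.cast_eq_zero.1 h2) hn.ne'
    · exact h2
  let F : (Fin N → ℤ) →+ ℝ := AddMonoidHom.toMultiplicative.symm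
    ((QuotientGroup.lift _ (Abelianization.lift f) htors).comp e.symm.toMonoidHom)
  have hF : ∀ g, F (Multiplicative.toAdd (e (QuotientGroup.mk (Abelianization.of g)))) = L g := by
    intro g
    change Multiplicative.toAdd (QuotientGroup.lift _ (Abelianization.lift f) htors
      (e.symm (e (QuotientGroup.mk (Abelianization.of g))))) = L g
    rw [MulEquiv.symm_apply_apply]
    rfl
  refine ⟨Fintype.linearCombination ℝ fun i => F (Pi.single i 1), fun g => ?_⟩
  rw [← hF, Fintype.linearCombination_apply]
  set v : Fin N → ℤ := Multiplicative.toAdd (e (QuotientGroup.mk (Abelianization.of g)))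
  conv_rhs => rw [← Finset.univ_sum_single v, map_sum]
  refine Finset.sum_congr rfl fun i _ => ?_
  have : Pi.single i (v i) = v i • (Pi.single i 1 : Fin N → ℤ) := by
    rw [← Pi.single_smul, smul_eq_mul, mul_one]
  rw [this, map_zsmul, zsmul_eq_mul, smul_eq_mul]
  rfl

end Projection

/-! ### Facet points -/

section FacetPoint

variable {G : Type*} [Group G] {S : Set G} {L : G → ℝ}

lemma wordDist_eq_sub_of_inv_mul_mem (hgen : Subgroup.closure S = ⊤) (hsymm : ∀ s ∈ S, s⁻¹ ∈ S)
    (hL : ∀ a b, L (a * b) = L a + L b) (hS : ∀ s ∈ S, L s ≤ 1) {u v : G}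
    (h : u⁻¹ * v ∈ Submonoid.closure {s | s ∈ S ∧ L s = 1}) :
    (wordDist S u v : ℝ) = L v - L u := by
  rw [wordDist_eq_additive hgen hsymm hL hS h, hL, additive_inv hL]
  ring

variable [Group.IsNilpotent G]

/-- Every geodesic path from `1` with steps in `V = {s ∈ S | L s = 1}` is absorbed by the periodic
path of an admissible word. -/
lemma limit_periodicPath_le (hgen : Subgroup.closure S = ⊤) (hsymm : ∀ s ∈ S, s⁻¹ ∈ S)
    (hL : ∀ a b, L (a * b) = L a + L b) (hS : ∀ s ∈ S, L s ≤ 1) {w : List G}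
    (hw : IsFacetWord {s | s ∈ S ∧ L s = 1} w) (hw0 : w ≠ []) {γ : ℕ → G} (h0 : γ 0 = 1)
    (hγ : ∀ n, (γ n)⁻¹ * γ (n + 1) ∈ {s | s ∈ S ∧ L s = 1}) {η η' : G → ℝ}
    (hη : ConvergesTo S γ η) (hη' : ConvergesTo S (periodicPath w) η') : η' ≤ η := by
  have hp := periodicPath_step_mem hw.1 hw0
  refine limit_le_limit hgen hsymm (isGeodesicPath_of_steps hgen hsymm hL hS hγ) h0
    (isGeodesicPath_of_steps hgen hsymm hL hS hp) (periodicPath_zero w) hη hη' fun m => ?_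
  have hm := mem_closure_of_steps hγ (Nat.zero_le m)
  rw [h0, inv_one, one_mul] at hm
  -- After `q` full periods the periodic path is at a point reachable from `γ m` by a word in `V`.
  obtain ⟨q, hq⟩ := hw.exists_mul_pow_mem (inv_mem (submonoidClosure_le_closure _ hm))
  refine ⟨q * w.length, ?_⟩
  have h1 := hq q le_rfl
  rw [← periodicPath_length_mul] at h1
  rw [wordDist_eq_sub_of_inv_mul_mem hgen hsymm hL hS h1, additive_of_steps hL fun n => (hγ n).2,
    additive_of_steps hL fun n => (hp n).2, h0, periodicPath_zero]
  linarith

/-- If the limit of a geodesic path from `1` with steps in `V = {s ∈ S | L s = 1}` has a finite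
orbit, then that path absorbs the periodic path of every admissible word. -/
lemma limit_le_limit_periodicPath (hgen : Subgroup.closure S = ⊤) (hsymm : ∀ s ∈ S, s⁻¹ ∈ S)
    (hL : ∀ a b, L (a * b) = L a + L b) (hS : ∀ s ∈ S, L s ≤ 1) {w : List G}
    (hw : IsFacetWord {s | s ∈ S ∧ L s = 1} w) (hw0 : w ≠ []) {γ : ℕ → G} (h0 : γ 0 = 1)
    (hγ : ∀ n, (γ n)⁻¹ * γ (n + 1) ∈ {s | s ∈ S ∧ L s = 1}) {η η' : G → ℝ}
    (hη : ConvergesTo S γ η) (hη' : ConvergesTo S (periodicPath w) η')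
    (hfin : (horoOrbit η).Finite) : η ≤ η' := by
  have hp := periodicPath_step_mem hw.1 hw0
  have hgeo := isGeodesicPath_of_steps hgen hsymm hL hS hγ
  have hLγ : ∀ n, L (γ n) = n := fun n => by
    rw [additive_of_steps hL (fun n => (hγ n).2), h0, additive_one hL, zero_add]
  have hlow : ∀ g, -L g ≤ η g := by
    intro g
    obtain ⟨n, hn⟩ := (hgeo.eventually_eq hgen hsymm h0 hη g).exists
    have := additive_le_wordDist hgen hsymm hL hS g (γ n)
    rw [hL, additive_inv hL, hLγ] at this
    linarith
  -- On the kernel `η` is odd, so the lower bound applied to both `k` and `k⁻¹` is an equality.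
  have hK : ∀ k ∈ orbitKernel η, η k = -L k := by
    intro k hk
    have h1 := hlow k⁻¹
    rw [apply_inv_of_mem_orbitKernel hη.apply_one hk, additive_inv hL] at h1
    linarith [hlow k]
  refine limit_le_limit hgen hsymm (isGeodesicPath_of_steps hgen hsymm hL hS hp)
    (periodicPath_zero w) hgeo h0 hη' hη fun m => ?_
  have hm := mem_closure_of_steps hp (Nat.zero_le m)
  rw [periodicPath_zero, inv_one, one_mul] at hm
  obtain ⟨p, hpq⟩ := hw.exists_mul_pow_mem (inv_mem (submonoidClosure_le_closure _ hm))
  have hidx := (orbitKernel_finiteIndex hfin).index_ne_zero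
  set r := (orbitKernel η).index
  -- The exponent `r * p` is at least `p`, for absorption, and a multiple of the index, so that the
  -- power lies in the kernel.
  have h1 := hpq (r * p) (Nat.le_mul_of_pos_left p (Nat.pos_of_ne_zero hidx))
  have hmem : w.prod ^ (r * p) ∈ orbitKernel η := by
    rw [pow_mul]
    exact pow_mem ((orbitKernel η).pow_index_mem _) p
  set g := w.prod ^ (r * p)
  -- Since `η g = -L g`, the distance from `g` to `γ n` is `n - L g`; going through `g` thus costs
  -- `n - m` in total.
  obtain ⟨n, hn⟩ := (hgeo.eventually_eq hgen hsymm h0 hη g).exists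
  refine ⟨n, ?_⟩
  have h2 := wordDist_eq_sub_of_inv_mul_mem hgen hsymm hL hS h1
  have h3 : (wordDist S (periodicPath w m) (γ n) : ℝ) ≤
      wordDist S (periodicPath w m) g + wordDist S g (γ n) := by
    exact_mod_cast wordDist_triangle hgen hsymm _ g _
  rw [additive_of_steps hL (fun n => (hp n).2) m, periodicPath_zero, additive_one hL] at h2
  rw [hK g hmem] at hn
  linarith

/-- All admissible words give periodic paths with one and the same limit. -/
lemma exists_limit_periodicPath (hS0 : S.Finite) (hgen : Subgroup.closure S = ⊤)
    (hsymm : ∀ s ∈ S, s⁻¹ ∈ S) (hL : ∀ a b, L (a * b) = L a + L b) (hS : ∀ s ∈ S, L s ≤ 1)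
    (hne : {s | s ∈ S ∧ L s = 1}.Nonempty) :
    (∃ w : List G, IsFacetWord {s | s ∈ S ∧ L s = 1} w ∧ w ≠ []) ∧
      ∃ ζ : G → ℝ, ∀ w : List G, IsFacetWord {s | s ∈ S ∧ L s = 1} w →
        IsGeodesicPath S (periodicPath w) ∧ ConvergesTo S (periodicPath w) ζ := by
  have h1 : (1 : G) ∉ {s | s ∈ S ∧ L s = 1} := fun h => by
    have := h.2
    rw [additive_one hL] at this
    exact zero_ne_one this
  have hgeo : ∀ w, IsFacetWord {s | s ∈ S ∧ L s = 1} w → IsGeodesicPath S (periodicPath w) :=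
    fun w hw => isGeodesicPath_of_steps hgen hsymm hL hS
      (periodicPath_step_mem hw.1 (hw.ne_nil hne h1))
  obtain ⟨w₀, hw₀⟩ := exists_isFacetWord (hS0.subset fun s (hs : s ∈ {s | s ∈ S ∧ L s = 1}) => hs.1)
  obtain ⟨ζ, hζ⟩ := (hgeo w₀ hw₀).exists_convergesTo hgen hsymm (periodicPath_zero w₀)
  refine ⟨⟨w₀, hw₀, hw₀.ne_nil hne h1⟩, ζ, fun w hw => ⟨hgeo w hw, ?_⟩⟩
  obtain ⟨ζ', hζ'⟩ := (hgeo w hw).exists_convergesTo hgen hsymm (periodicPath_zero w)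
  have hle := limit_periodicPath_le hgen hsymm hL hS hw₀ (hw₀.ne_nil hne h1) (periodicPath_zero w)
    (periodicPath_step_mem hw.1 (hw.ne_nil hne h1)) hζ' hζ
  have hge := limit_periodicPath_le hgen hsymm hL hS hw (hw.ne_nil hne h1) (periodicPath_zero w₀)
    (periodicPath_step_mem hw₀.1 (hw₀.ne_nil hne h1)) hζ hζ'
  rwa [le_antisymm hle hge]

/-- The direction of a geodesic path converging to a point with finite orbit lies over a facet,
which is cut out by a homomorphism `L : G → ℝ`. -/
lemma exists_facet_of_direction (hS0 : S.Finite) (hgen : Subgroup.closure S = ⊤)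
    (hsymm : ∀ s ∈ S, s⁻¹ ∈ S) {N : ℕ} (e : FreeAb G ≃* Multiplicative (Fin N → ℤ))
    {γ : ℕ → G} {ξ : G → ℝ} (hγ : IsGeodesicPath S γ) (hξ : ConvergesTo S γ ξ)
    (hfin : (horoOrbit ξ).Finite) :
    ∃ F : Set (Fin N → ℝ), IsFacet (genPolytope S e) F ∧
      ∃ L : G → ℝ, (∀ a b, L (a * b) = L a + L b) ∧ (∀ s ∈ S, L s ≤ 1) ∧
        facetGens S e F = {s | s ∈ S ∧ L s = 1} ∧ direction γ ⊆ facetGens S e F := by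
  obtain ⟨L₀, hL₀, hS₀, hd⟩ := exists_additive_eq_one_on_direction hgen hsymm hγ hξ hfin
  obtain ⟨l₀, hl₀⟩ := exists_linear_of_additive e hL₀
  obtain ⟨l, hl, htight, hspan⟩ := exists_tight_spanning (hS0.image (phi e)) (span_phi_image e hgen)
    (l₀ := l₀) (by rintro _ ⟨s, hs, rfl⟩; rw [hl₀]; exact hS₀ s hs)
  have hdS := direction_subset hsymm hγ
  have hone : ∀ s ∈ direction γ, l (phi e s) = 1 := fun s hs =>
    htight _ ⟨s, hdS hs, rfl⟩ (by rw [hl₀]; exact hd s hs)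
  obtain ⟨s₀, hs₀⟩ := direction_nonempty hS0 hsymm hγ
  have hsub := subset_convexHull ℝ (phi e '' S)
  have hgens : facetGens S e {x | x ∈ convexHull ℝ (phi e '' S) ∧ l x = 1} =
      {s | s ∈ S ∧ l (phi e s) = 1} := by
    ext s
    exact and_congr_right fun hs => and_iff_right (hsub ⟨s, hs, rfl⟩)
  refine ⟨_, isFacet_of_tight_spanning ?_ hl hspan ⟨_, ⟨s₀, hdS hs₀, rfl⟩, hone s₀ hs₀⟩,
    fun g => l (phi e g), fun a b => by simp only [phi_mul, map_add], fun s hs => hl _ ⟨s, hs, rfl⟩,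
    hgens, ?_⟩
  · rintro _ ⟨s, hs, rfl⟩
    exact ⟨s⁻¹, hsymm s hs, phi_inv e s⟩
  · rw [hgens]
    exact fun s hs => ⟨hdS hs, hone s hs⟩

end FacetPoint

end NilpotentHoro

/-! ### Busemann points with finite orbit and directions of geodesics -/

theorem mainTheorem2 {G : Type*} [Group G] [Group.IsNilpotent G]
    (S : Set G) (hfin : S.Finite) (hgen : Subgroup.closure S = ⊤)
    (hsymm : ∀ s ∈ S, s⁻¹ ∈ S)
    {N : ℕ} (e : NilpotentHoro.FreeAb G ≃* Multiplicative (Fin N → ℤ)) :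
    (∀ ξ : G → ℝ, NilpotentHoro.IsBusemannPoint S ξ → (NilpotentHoro.horoOrbit ξ).Finite →
      ∃ F : Set (Fin N → ℝ), NilpotentHoro.IsFacet (NilpotentHoro.genPolytope S e) F ∧
        ∃ ξF : G → ℝ, NilpotentHoro.IsFacetPoint S e F ξF ∧
          NilpotentHoro.horoOrbit ξ = NilpotentHoro.horoOrbit ξF) ∧
    (∀ (γ : ℕ → G) (ξ : G → ℝ), NilpotentHoro.IsGeodesicPath S γ →
      NilpotentHoro.ConvergesTo S γ ξ → (NilpotentHoro.horoOrbit ξ).Finite →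
      ∃ F : Set (Fin N → ℝ), NilpotentHoro.IsFacet (NilpotentHoro.genPolytope S e) F ∧
        NilpotentHoro.phi e '' NilpotentHoro.direction γ ⊆ F) := by
  open NilpotentHoro in
  constructor
  · rintro ξ ⟨-, γ, hγ, hξ⟩ horb
    obtain ⟨F, hF, L, hL, hS, hgens, hdir⟩ :=
      exists_facet_of_direction hfin hgen hsymm e hγ hξ horb
    rw [hgens] at hdir
    have hne := (direction_nonempty hfin hsymm hγ).mono hdir
    obtain ⟨⟨w, hw, hw0⟩, ζ, hζ⟩ := exists_limit_periodicPath hfin hgen hsymm hL hS hne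
    refine ⟨F, hF, ζ, ⟨⟨w, hgens ▸ hw⟩, fun w' hw' => hζ w' (hgens ▸ hw')⟩, ?_⟩
    -- From time `k` on all steps belong to the direction, hence satisfy `L = 1`. Translating the
    -- tail to start at `1` replaces `ξ` by a point of the same orbit.
    obtain ⟨k, hk⟩ := eventually_atTop.1 (eventually_step_mem_direction hfin hsymm hγ)
    have hξ' := hξ.translate_tail hgen hsymm (γ k)⁻¹ k
    have hsteps : ∀ n, ((γ k)⁻¹ * γ (k + n))⁻¹ * ((γ k)⁻¹ * γ (k + (n + 1))) ∈
        {s | s ∈ S ∧ L s = 1} := by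
      intro n
      have := hdir (hk (k + n) (Nat.le_add_right k n))
      simpa [mul_assoc, add_assoc] using this
    have h0 : (γ k)⁻¹ * γ (k + 0) = 1 := by simp
    have heq : horoAct (γ k)⁻¹ ξ = ζ := le_antisymm
      (limit_le_limit_periodicPath hgen hsymm hL hS hw hw0 h0 hsteps hξ' (hζ w hw).2
        (by rwa [horoOrbit_horoAct]))
      (limit_periodicPath_le hgen hsymm hL hS hw hw0 h0 hsteps hξ' (hζ w hw).2)
    rw [← heq, horoOrbit_horoAct]
  · intro γ ξ hγ hξ horb
    obtain ⟨F, hF, -, -, -, -, hdir⟩ := exists_facet_of_direction hfin hgen hsymm e hγ hξ horb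
    refine ⟨F, hF, ?_⟩
    rintro _ ⟨s, hs, rfl⟩
    exact (hdir hs).2
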